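/- Let $K>1$, $n\ge 1$, $m\ge 0$ be integers, $y^*\in\mathbb R^m$, $\sigma_w>0$, let $\Pi\subset\mathbb R^n$ be convex and compact, and let $\Theta\subset\mathbb R^{K\times m\times(n+1)}$ be a compact set of parameters $\theta=(A_k,b_k)_{k=1}^K$, $A_k\in\mathbb R^{m\times n}$, $b_k\in\mathbb R^m$. **Model.** Let $(s_t)_{t\ge 0}$ be a Markov chain on $\{1,\dots,K\}$ with transition matrix $P=(p_{i,j})$. In period $t\ge1$ the input $x_t\in\mathbb R^n$ produces the output $y_t=A_{s_t}x_t+b_{s_t}+w_t$, where, given the states, the noises $w_t$ are independent and $w_t$ has law $f_{s_t}$. For the quadratic stage cost $\mathbb E(\|y^*-y_t\|_2^2\mid s_{t-1}=i,\,x_t)$ the optimal input is $$x_i^*(\theta,P)=\Bigl(\sum_j p_{i,j}A_j^{\top}A_j\Bigr)^{-1}\sum_j p_{i,j}A_j^{\top}(y^*-b_j).$$ A triple $(\theta,P,(f_k)_{k=1}^K)$ is *admissible* if $\theta\in\Theta$, every $A_k$ has full column rank, $P$ is a stochastic matrix, every $f_k$ is a probability law with mean zero whose entries satisfy $\mathbb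 E(w_{t,i}^2)\le\sigma_w^2$ and $\mathbb E(w_{t,i}^4)\le\sigma_w^4$, and $x_i^*(\theta,P)\in\Pi$ for every state $i$. **Policies.** A policy $\mu$ chooses $x_t^\mu$ as a measurable function of $I_{t-1}=(x_1,\dots,x_{t-1},y_1,\dots,y_{t-1},s_0,\dots,s_{t-1})$ and of a random seed that is independent of the states and the noises; a sequence of estimates $(\hat x_t^\mu)$ of the optimal input is obtained in the same way, as measurable functions of $I_{t-1}$ and the seed. Put $$\hat{\mathcal E}_T^\mu=\sup\,\mathbb E\sum_{t=1}^T\|\hat x_t^\mu-x_{s_{t-1}}^*(\theta,P)\|_2^2,\qquad \bar{\mathcal E}_T^\mu=\sup\,\mathbb E\sum_{t=1}^T\|x_t^\mu-x_{s_{t-1}}^*(\theta,P)\|_2^2,$$ both suprema (in $[0,\infty]$) being over all admissible $(\theta,P,(f_k)_k)$. **Theorem.** Assume that $\Theta$ has an interior point $\theta^\circ$ whose matrices all have full column rank and for which the optimal input under the uniform transition matrix ($p_{i,j}=1/K$) lies in the interior of $\Pi$. Then there is a constant $C>0$, depending only on $K,m,n,y^*,\sigma_w,\Theta,\Pi$,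 such that for every initial distribution of $s_0$, every policy $\mu$, every sequence of estimates $(\hat x_t^\mu)$ and every $T\in\mathbb N$, $$\hat{\mathcal E}_T^\mu\;\bar{\mathcal E}_T^\mu\;\ge\;C\,T .$$ -/

import Mathlib

open MeasureTheory Matrix WithLp
open scoped ENNReal

noncomputable section

namespace JumpAffine

/-- System parameters `θ = (A_k, b_k)`, `k = 1, …, K`, with `A_k ∈ ℝ^{m × n}` and `b_k ∈ ℝ^m`. -/
abbrev Param (K m n : ℕ) : Type :=
  Fin K → Matrix (Fin m) (Fin n) ℝ × EuclideanSpace ℝ (Fin m)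

/-- The affine response `A x + b` of one state. -/
def response {m n : ℕ} (q : Matrix (Fin m) (Fin n) ℝ × EuclideanSpace ℝ (Fin m))
    (x : EuclideanSpace ℝ (Fin n)) : EuclideanSpace ℝ (Fin m) :=
  toLp 2 (q.1 *ᵥ ofLp x) + q.2

/-- The quadratic stage cost `E (‖y* - y_t‖² | s_{t-1} = i, x_t = x)`, where the next state `j`
has probability `p_{i,j}` and the noise in state `j` has law `f j`. -/
def stageCost {K m n : ℕ} (ystar : EuclideanSpace ℝ (Fin m)) (θ : Param K m n)
    (P : Matrix (Fin K) (Fin K) ℝ) (f : Fin K → Measure (EuclideanSpace ℝ (Fin m)))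
    (i : Fin K) (x : EuclideanSpace ℝ (Fin n)) : ℝ :=
  ∑ j, P i j * ∫ w, ‖ystar - (response (θ j) x + w)‖ ^ 2 ∂(f j)

/-- The optimal input
`x*_i = (∑_j p_{i,j} A_jᵀ A_j)⁻¹ (∑_j p_{i,j} A_jᵀ (y* - b_j))` after state `i`. It is the unique
minimizer of the stage cost, see `stageCost_optimalInput_lt`. -/
def optimalInput {K m n : ℕ} (ystar : EuclideanSpace ℝ (Fin m)) (θ : Param K m n)
    (P : Matrix (Fin K) (Fin K) ℝ) (i : Fin K) : EuclideanSpace ℝ (Fin n) :=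
  toLp 2 ((∑ j, P i j • ((θ j).1ᵀ * (θ j).1))⁻¹ *ᵥ
    (∑ j, P i j • ((θ j).1ᵀ *ᵥ ofLp (ystar - (θ j).2))))

/-- Noise laws: centred, with entries satisfying `E w_i² ≤ σ²` and `E w_i⁴ ≤ σ⁴`. -/
structure IsNoiseLaw {m : ℕ} (σ : ℝ) (f : Measure (EuclideanSpace ℝ (Fin m))) : Prop where
  isProbabilityMeasure : IsProbabilityMeasure f
  mean_zero : ∫ w, w ∂f = 0
  second_moment : ∀ i, ∫⁻ w, ‖w i‖ₑ ^ 2 ∂f ≤ ENNReal.ofReal (σ ^ 2)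
  fourth_moment : ∀ i, ∫⁻ w, ‖w i‖ₑ ^ 4 ∂f ≤ ENNReal.ofReal (σ ^ 4)

/-- If the `A_k` have full column rank, `optimalInput` is the unique minimizer of the stage cost. -/
theorem stageCost_optimalInput_lt {K m n : ℕ} {ystar : EuclideanSpace ℝ (Fin m)} {σ : ℝ}
    {θ : Param K m n} {P : Matrix (Fin K) (Fin K) ℝ}
    {f : Fin K → Measure (EuclideanSpace ℝ (Fin m))}
    (hθ : ∀ k, (θ k).1.rank = n) (hP : P ∈ rowStochastic ℝ (Fin K))
    (hf : ∀ k, IsNoiseLaw σ (f k)) (i : Fin K) {x : EuclideanSpace ℝ (Fin n)}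
    (hx : x ≠ optimalInput ystar θ P i) :
    stageCost ystar θ P f i (optimalInput ystar θ P i) < stageCost ystar θ P f i x := by
  obtain ⟨hP0, hP1⟩ := mem_rowStochastic_iff_sum.1 hP
  have hinj : ∀ k (v : Fin n → ℝ), (θ k).1 *ᵥ v = 0 → v = 0 := by
    intro k v hv
    have h1 := LinearMap.finrank_range_add_finrank_ker (θ k).1.mulVecLin
    have h2 : Module.finrank ℝ (LinearMap.range (θ k).1.mulVecLin) = n := hθ k
    rw [h2, Module.finrank_fin_fun] at h1
    have h3 : LinearMap.ker (θ k).1.mulVecLin = ⊥ :=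
      Submodule.finrank_eq_zero.1 (by omega)
    exact LinearMap.ker_eq_bot'.1 h3 v hv
  have hpos : ∃ j, 0 < P i j := by
    by_contra! h
    have := Finset.sum_nonpos (s := Finset.univ) (f := fun j => P i j) (fun j _ => h j)
    rw [hP1 i] at this
    linarith
  -- the quadratic form of `∑ p A^T A` is definite
  have hdef : ∀ v : Fin n → ℝ, v ≠ 0 →
      0 < ∑ j, P i j * (((θ j).1 *ᵥ v) ⬝ᵥ ((θ j).1 *ᵥ v)) := by
    intro v hv
    obtain ⟨j, hj⟩ := hpos
    refine Finset.sum_pos' (fun k _ => mul_nonneg (hP0 i k) (by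
      simpa using dotProduct_star_self_nonneg ((θ k).1 *ᵥ v))) ⟨j, Finset.mem_univ _, ?_⟩
    refine mul_pos hj (lt_of_le_of_ne (by
      simpa using dotProduct_star_self_nonneg ((θ j).1 *ᵥ v)) ?_)
    intro h
    exact hv (hinj j v (dotProduct_self_eq_zero.1 h.symm))
  set G : Matrix (Fin n) (Fin n) ℝ := ∑ j, P i j • ((θ j).1ᵀ * (θ j).1) with hG
  have hGv : ∀ v, G *ᵥ v = ∑ j, P i j • ((θ j).1ᵀ *ᵥ ((θ j).1 *ᵥ v)) := by
    intro v
    simp [hG, sum_mulVec, smul_mulVec, mulVec_mulVec]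
  have hdet : IsUnit G.det := by
    rw [isUnit_iff_ne_zero]
    intro h
    obtain ⟨v, hv, hv0⟩ := exists_mulVec_eq_zero_iff.2 h
    have h1 := hdef v hv
    have h2 : v ⬝ᵥ (G *ᵥ v) = ∑ j, P i j * (((θ j).1 *ᵥ v) ⬝ᵥ ((θ j).1 *ᵥ v)) := by
      rw [hGv, dotProduct_sum]
      refine Finset.sum_congr rfl fun j _ => ?_
      rw [dotProduct_smul, smul_eq_mul, dotProduct_mulVec, vecMul_transpose]
    rw [hv0, dotProduct_zero] at h2
    linarith
  set xs := optimalInput ystar θ P i with hxs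
  have hnormal : ∑ j, P i j • ((θ j).1ᵀ *ᵥ ofLp (ystar - response (θ j) xs)) = 0 := by
    have h1 : G *ᵥ ofLp xs = ∑ j, P i j • ((θ j).1ᵀ *ᵥ ofLp (ystar - (θ j).2)) := by
      rw [hxs, optimalInput, mulVec_mulVec, ← hG, mul_nonsing_inv _ hdet, one_mulVec]
    rw [hGv] at h1
    rw [← sub_eq_zero.2 h1.symm, ← Finset.sum_sub_distrib]
    refine Finset.sum_congr rfl fun j _ => ?_
    rw [← smul_sub, ← mulVec_sub]
    congr 2
    simp only [response, ofLp_sub, ofLp_add]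
    abel
  have hint : ∀ j (a : EuclideanSpace ℝ (Fin m)),
      ∫ w, ‖a - w‖ ^ 2 ∂(f j) = ‖a‖ ^ 2 + ∫ w, ‖w‖ ^ 2 ∂(f j) := by
    intro j a
    have := (hf j).isProbabilityMeasure
    have hL2 : MemLp (fun w : EuclideanSpace ℝ (Fin m) => w) 2 (f j) := by
      refine ⟨by fun_prop, ?_⟩
      rw [eLpNorm_lt_top_iff_lintegral_rpow_enorm_lt_top (by norm_num) (by norm_num)]
      have h1 : ∀ w : EuclideanSpace ℝ (Fin m),
          ‖w‖ₑ ^ (2 : ℝ≥0∞).toReal = ∑ l, ‖w l‖ₑ ^ 2 := by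
        intro w
        have h2 : ‖w‖ₑ ^ 2 = ∑ l, ‖w l‖ₑ ^ 2 := by
          simp only [← ofReal_norm, ← ENNReal.ofReal_pow (norm_nonneg _)]
          rw [EuclideanSpace.norm_sq_eq, ENNReal.ofReal_sum_of_nonneg (fun _ _ => by positivity)]
        rw [← h2]
        simp
      simp only [h1]
      rw [lintegral_finsetSum _ (fun l _ => by fun_prop)]
      exact ENNReal.sum_lt_top.2 fun l _ =>
        ((hf j).second_moment l).trans_lt ENNReal.ofReal_lt_top
    have hI : Integrable (fun w : EuclideanSpace ℝ (Fin m) => w) (f j) :=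
      hL2.integrable (by norm_num)
    have hI2 : Integrable (fun w : EuclideanSpace ℝ (Fin m) => ‖w‖ ^ 2) (f j) :=
      hL2.integrable_norm_pow (by norm_num)
    have hI3 : Integrable (fun w : EuclideanSpace ℝ (Fin m) => 2 * inner ℝ a w) (f j) :=
      (hI.const_inner a).const_mul 2
    simp only [norm_sub_sq_real]
    have e1 : ∫ w, (‖a‖ ^ 2 - 2 * inner ℝ a w + ‖w‖ ^ 2) ∂(f j) =
        ∫ w, (‖a‖ ^ 2 - 2 * inner ℝ a w) ∂(f j) + ∫ w, ‖w‖ ^ 2 ∂(f j) :=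
      integral_add ((integrable_const _).sub hI3) hI2
    have e2 : ∫ w, (‖a‖ ^ 2 - 2 * inner ℝ a w) ∂(f j) =
        ∫ _, ‖a‖ ^ 2 ∂(f j) - ∫ w, 2 * inner ℝ a w ∂(f j) :=
      integral_sub (integrable_const _) hI3
    rw [e1, e2, integral_const_mul, integral_inner hI, (hf j).mean_zero]
    simp
  have hcost : ∀ z, stageCost ystar θ P f i z =
      ∑ j, P i j * (‖ystar - response (θ j) z‖ ^ 2 + ∫ w, ‖w‖ ^ 2 ∂(f j)) := by
    intro z
    refine Finset.sum_congr rfl fun j _ => ?_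
    rw [← hint]
    simp only [sub_sub]
  have hd : ofLp (x - xs) ≠ 0 := by
    intro h
    exact hx (sub_eq_zero.1 ((ofLp_eq_zero 2).1 h))
  have key : stageCost ystar θ P f i x = stageCost ystar θ P f i xs +
      ∑ j, P i j * (((θ j).1 *ᵥ ofLp (x - xs)) ⬝ᵥ ((θ j).1 *ᵥ ofLp (x - xs))) := by
    have hcross : ∑ j, P i j *
        (((θ j).1 *ᵥ ofLp (x - xs)) ⬝ᵥ ofLp (ystar - response (θ j) xs)) = 0 := by
      have h1 := congrArg (fun v => ofLp (x - xs) ⬝ᵥ v) hnormal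
      simp only [dotProduct_sum, dotProduct_zero, dotProduct_smul, smul_eq_mul] at h1
      rw [← h1]
      refine Finset.sum_congr rfl fun j _ => ?_
      rw [dotProduct_mulVec, vecMul_transpose]
    have hterm : ∀ j, ‖ystar - response (θ j) x‖ ^ 2 = ‖ystar - response (θ j) xs‖ ^ 2
        + ((θ j).1 *ᵥ ofLp (x - xs)) ⬝ᵥ ((θ j).1 *ᵥ ofLp (x - xs))
        - 2 * (((θ j).1 *ᵥ ofLp (x - xs)) ⬝ᵥ ofLp (ystar - response (θ j) xs)) := by
      intro j
      have h1 : ystar - response (θ j) x = (ystar - response (θ j) xs) -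
          toLp 2 ((θ j).1 *ᵥ ofLp (x - xs)) := by
        simp only [response, ofLp_sub, mulVec_sub, toLp_sub]
        abel
      have h2 : ∀ v : EuclideanSpace ℝ (Fin m), ‖v‖ ^ 2 = ofLp v ⬝ᵥ ofLp v := by
        intro v
        rw [EuclideanSpace.norm_sq_eq]
        simp [dotProduct, sq]
      rw [h1, h2, h2, ofLp_sub]
      generalize (θ j).1 *ᵥ ofLp (x - xs) = p
      generalize ofLp (ystar - response (θ j) xs) = q
      simp only [sub_dotProduct, dotProduct_sub]
      rw [dotProduct_comm q p]
      ring
    have h3 := congrArg (fun r => 2 * r) hcross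
    simp only [mul_zero, Finset.mul_sum] at h3
    rw [hcost, hcost, ← Finset.sum_add_distrib, ← sub_eq_zero, ← neg_zero, ← h3,
      ← Finset.sum_sub_distrib, ← Finset.sum_neg_distrib]
    refine Finset.sum_congr rfl fun j _ => ?_
    rw [hterm]
    ring
  rw [key]
  linarith [hdef _ hd]

/-- The class of models `(θ, P, f)` over which the worst case is taken. -/
structure IsAdmissible {K m n : ℕ} (ystar : EuclideanSpace ℝ (Fin m)) (σ : ℝ)
    (Θ : Set (Param K m n)) (Pi0 : Set (EuclideanSpace ℝ (Fin n)))
    (θ : Param K m n) (P : Matrix (Fin K) (Fin K) ℝ)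
    (f : Fin K → Measure (EuclideanSpace ℝ (Fin m))) : Prop where
  mem : θ ∈ Θ
  full_rank : ∀ k, (θ k).1.rank = n
  stochastic : P ∈ rowStochastic ℝ (Fin K)
  noise : ∀ k, IsNoiseLaw σ (f k)
  optimalInput_mem : ∀ i, optimalInput ystar θ P i ∈ Pi0

/-- The information available after `t` periods:
`(x_1, …, x_t)`, `(y_1, …, y_t)` and `(s_0, …, s_t)`. -/
abbrev History (K m n t : ℕ) : Type :=
  (Fin t → EuclideanSpace ℝ (Fin n)) × (Fin t → EuclideanSpace ℝ (Fin m)) ×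
    (Fin (t + 1) → Fin K)

/-- A sequence of (possibly randomized) non-anticipating rules: `toFun t` maps an internal random
seed and the information after `t` periods to a vector of `ℝ^n` for period `t + 1`.
Both policies and sequences of estimates of the optimal input are of this kind. -/
structure CausalRule (K m n : ℕ) (U : Type*) [MeasurableSpace U] where
  toFun : (t : ℕ) → U × History K m n t → EuclideanSpace ℝ (Fin n)
  measurable_toFun : ∀ t, Measurable (toFun t)

section Trajectory

variable {K m n T : ℕ} {U : Type*} [MeasurableSpace U]

/-- The information after `t` periods when the policy `μ` runs on the system `θ` with seed `u`,
states `s_0, …, s_T` and noises `w_1, …, w_T` (the noise of period `t + 1` is `w t`):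
in period `t + 1` the input is `x = μ_t(u, I_t)` and the output is
`A_{s_{t+1}} x + b_{s_{t+1}} + w_{t+1}`. -/
def history (θ : Param K m n) (μ : CausalRule K m n U) (u : U) (s : Fin (T + 1) → Fin K)
    (w : Fin T → EuclideanSpace ℝ (Fin m)) : (t : ℕ) → t ≤ T → History K m n t
  | 0, _ => (Fin.elim0, Fin.elim0, fun _ => s 0)
  | t + 1, h =>
    let I := history θ μ u s w t (Nat.le_of_succ_le h)
    let x := μ.toFun t (u, I)
    let j := s ⟨t + 1, Nat.lt_succ_of_le h⟩
    (Fin.snoc I.1 x, Fin.snoc I.2.1 (response (θ j) x + w ⟨t, h⟩), Fin.snoc I.2.2 j)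

/-- Probability of the state path `s_0, …, s_T` of the Markov chain with initial distribution `π`
and transition matrix `P`. -/
def pathProb (π : Fin K → ℝ) (P : Matrix (Fin K) (Fin K) ℝ) (s : Fin (T + 1) → Fin K) : ℝ :=
  π (s 0) * ∏ t : Fin T, P (s t.castSucc) (s t.succ)

/-- Joint law of the seed, the states `s_0, …, s_T` and the noises `w_1, …, w_T`: the seed has law
`ρ` and is independent of the rest, the states form a Markov chain, and, given the states, the
noises are independent, `w_t` having law `f_{s_t}`. -/
def systemLaw (T : ℕ) (ρ : Measure U) (π : Fin K → ℝ) (P : Matrix (Fin K) (Fin K) ℝ)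
    (f : Fin K → Measure (EuclideanSpace ℝ (Fin m))) :
    Measure (U × (Fin (T + 1) → Fin K) × (Fin T → EuclideanSpace ℝ (Fin m))) :=
  ∑ s : Fin (T + 1) → Fin K, ENNReal.ofReal (pathProb π P s) •
    ρ.prod ((Measure.dirac s).prod (Measure.pi fun t : Fin T => f (s t.succ)))

/-- The cumulative mean squared error `E ∑_{t=1}^T ‖x̂_t - x*_{s_{t-1}}‖²` of the estimates `est`
computed from the data that the policy `μ` generates. -/
def cumulativeMSE (T : ℕ) (ystar : EuclideanSpace ℝ (Fin m)) (ρ : Measure U) (π : Fin K → ℝ)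
    (μ est : CausalRule K m n U) (θ : Param K m n) (P : Matrix (Fin K) (Fin K) ℝ)
    (f : Fin K → Measure (EuclideanSpace ℝ (Fin m))) : ℝ≥0∞ :=
  ∫⁻ ω, ∑ t : Fin T,
    ‖est.toFun t (ω.1, history θ μ ω.1 ω.2.1 ω.2.2 t t.isLt.le) -
      optimalInput ystar θ P (ω.2.1 t.castSucc)‖ₑ ^ 2 ∂(systemLaw T ρ π P f)

/-- Worst-case cumulative estimation-MSE of the estimates `est` under the policy `μ`. -/
def worstEstimationMSE (T : ℕ) (ystar : EuclideanSpace ℝ (Fin m)) (σ : ℝ)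
    (Θ : Set (Param K m n)) (Pi0 : Set (EuclideanSpace ℝ (Fin n))) (ρ : Measure U)
    (π : Fin K → ℝ) (μ est : CausalRule K m n U) : ℝ≥0∞ :=
  ⨆ (θ : Param K m n) (P : Matrix (Fin K) (Fin K) ℝ)
    (f : Fin K → Measure (EuclideanSpace ℝ (Fin m)))
    (_ : IsAdmissible ystar σ Θ Pi0 θ P f), cumulativeMSE T ystar ρ π μ est θ P f

/-- Worst-case cumulative input-MSE `sup E ∑_{t=1}^T ‖x_t - x*_{s_{t-1}}‖²` of the policy `μ`. -/
def worstInputMSE (T : ℕ) (ystar : EuclideanSpace ℝ (Fin m)) (σ : ℝ)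
    (Θ : Set (Param K m n)) (Pi0 : Set (EuclideanSpace ℝ (Fin n))) (ρ : Measure U)
    (π : Fin K → ℝ) (μ : CausalRule K m n U) : ℝ≥0∞ :=
  ⨆ (θ : Param K m n) (P : Matrix (Fin K) (Fin K) ℝ)
    (f : Fin K → Measure (EuclideanSpace ℝ (Fin m)))
    (_ : IsAdmissible ystar σ Θ Pi0 θ P f), cumulativeMSE T ystar ρ π μ μ θ P f

end Trajectory

end JumpAffine

end

open ProbabilityTheory Filter Topology

/-! The proof is a two-point argument in which the input error itself bounds the information. Take
uniform transitions, so that one input `x` is optimal after every state, and a state `k` whose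
residual `q = A_k x + b_k - y*` is nonzero. Replacing `A_k` by `A_k + δ q eᵢᵀ` and `b_k` by `b_k - δ
xᵢ q` (`tilt`) leaves every response at `x` unchanged, yet moves the gradient of the cost at `x` by
a multiple of `δ ‖q‖² eᵢ`, hence the optimal input by a distance of order `δ`
(`exists_tilt_bounds`). The two systems are thus distinguishable only through inputs that differ
from `x`.

The noise is Gaussian along the line of `q`. In period `t` the two systems then differ by a
predictable shift of a scalar Gaussian, of size at most a constant times `δ ‖x_t - x‖`. The expected
sum of squared shifts is at most `M δ² I`, with `I` the worst input error. A change of measure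
(`two_point_bound`) shows that when `M δ² I` is small no estimate is good for both systems, so the
worst estimation error `E` is at least of order `T δ²`. Choosing `δ²` proportional to `1 / I` gives
`E * I ≥ C T` (`mul_ge_of_two_point`). This `δ` is small enough because `I` is bounded below: the
first input is chosen before any output is seen.

If all residuals vanish at the given interior point, a small change of the `b_k` produces a nonzero
one without moving the optimal input (`exists_interior_residual_ne_zero`); this needs two states. -/

namespace JumpAffine

/-! ### Predictable shifts of a Gaussian sequence and the two-point inequality -/

/-- The standard Gaussian measure on `ℝ^T`, as a product measure. -/
noncomputable abbrev gaussianSeq (T : ℕ) : Measure (Fin T → ℝ) :=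
  Measure.pi fun _ : Fin T => gaussianReal 0 1

/-- The value at time `t` depends only on the coordinates before `t`. -/
def IsPredictable {T : ℕ} (c : Fin T → (Fin T → ℝ) → ℝ) : Prop :=
  ∀ t w w', (∀ i < t, w i = w' i) → c t w = c t w'

theorem measurable_finCons {T : ℕ} :
    Measurable fun p : ℝ × (Fin T → ℝ) => (Fin.cons p.1 p.2 : Fin (T + 1) → ℝ) := by
  refine measurable_pi_iff.2 fun i => ?_
  refine Fin.cases ?_ (fun j => ?_) i
  · simpa using measurable_fst
  · simpa [Function.comp_def] using (measurable_pi_apply j).comp measurable_snd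

theorem lintegral_gaussianSeq_succ {T : ℕ} {G : (Fin (T + 1) → ℝ) → ℝ≥0∞} (hG : Measurable G) :
    ∫⁻ w, G w ∂gaussianSeq (T + 1) =
      ∫⁻ a, ∫⁻ w, G (Fin.cons a w) ∂gaussianSeq T ∂gaussianReal 0 1 := by
  have h := (measurePreserving_piFinSuccAbove (fun _ : Fin (T + 1) => gaussianReal 0 1) 0).symm
  rw [← h.lintegral_comp hG]
  refine (lintegral_prod _ (hG.comp h.measurable).aemeasurable).trans ?_
  simp [MeasurableEquiv.piFinSuccAbove_symm_apply, Fin.insertNthEquiv, Fin.insertNth_zero']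

theorem IsPredictable.cons {T : ℕ} {c : Fin (T + 1) → (Fin (T + 1) → ℝ) → ℝ}
    (hc : IsPredictable c) (a : ℝ) :
    IsPredictable fun (t : Fin T) (w : Fin T → ℝ) => c t.succ (Fin.cons a w) := by
  intro t w w' h
  refine hc _ _ _ fun i hi => ?_
  induction i using Fin.cases with
  | zero => rfl
  | succ j => simpa using h j (by simpa using hi)

theorem IsPredictable.zero_eq {T : ℕ} {c : Fin (T + 1) → (Fin (T + 1) → ℝ) → ℝ}
    (hc : IsPredictable c) (w : Fin (T + 1) → ℝ) : c 0 w = c 0 0 :=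
  hc _ _ _ fun i hi => absurd hi (Fin.not_lt_zero i)

/-- Translation invariance of Lebesgue measure; the exponential is the ratio of the Gaussian
densities at `x - c` and `x`. -/
theorem lintegral_gaussianReal_shift {H : ℝ → ℝ≥0∞} (hH : Measurable H) (c : ℝ) :
    ∫⁻ x, H x ∂gaussianReal 0 1 =
      ∫⁻ x, H (x - c) * ENNReal.ofReal (Real.exp (c * x - c ^ 2 / 2)) ∂gaussianReal 0 1 := by
  have hp : Measurable (gaussianPDF 0 1) := measurable_gaussianPDF 0 1
  rw [gaussianReal_of_var_ne_zero 0 one_ne_zero, lintegral_withDensity_eq_lintegral_mul _ hp hH,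
    lintegral_withDensity_eq_lintegral_mul _ hp (by fun_prop),
    ← lintegral_sub_right_eq_self _ c]
  refine lintegral_congr fun x => ?_
  simp only [Pi.mul_apply]
  have : gaussianPDF 0 1 (x - c) =
      gaussianPDF 0 1 x * ENNReal.ofReal (Real.exp (c * x - c ^ 2 / 2)) := by
    rw [gaussianPDF_def, ← ENNReal.ofReal_mul (gaussianPDFReal_nonneg _ _ _), gaussianPDFReal_def]
    simp only [mul_assoc, ← Real.exp_add]
    congr 3
    simp only [NNReal.coe_one]
    ring_nf
  rw [this]
  ring

theorem lintegral_gaussianReal_sq (b c : ℝ) :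
    ∫⁻ x, ENNReal.ofReal ((b + c * x) ^ 2) ∂gaussianReal 0 1 =
      ENNReal.ofReal (b ^ 2) + ENNReal.ofReal (c ^ 2) := by
  have hL : MemLp (fun x : ℝ => x) 2 (gaussianReal 0 1) := memLp_id_gaussianReal 2
  have h1 : Integrable (fun x : ℝ => x) (gaussianReal 0 1) := hL.integrable (by norm_num)
  have h2 : Integrable (fun x : ℝ => x ^ 2) (gaussianReal 0 1) := hL.integrable_sq
  have hsq : ∫ x : ℝ, x ^ 2 ∂gaussianReal 0 1 = 1 := by
    have h := variance_fun_id_gaussianReal (μ := 0) (v := 1)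
    rw [variance_eq_sub hL] at h
    simpa using h
  have e : (fun x : ℝ => (b + c * x) ^ 2) = fun x => b ^ 2 + (2 * b * c) * x + c ^ 2 * x ^ 2 := by
    funext x; ring
  have hi1 : Integrable (fun x : ℝ => b ^ 2 + (2 * b * c) * x) (gaussianReal 0 1) :=
    (integrable_const _).add (h1.const_mul _)
  have hi : Integrable (fun x : ℝ => (b + c * x) ^ 2) (gaussianReal 0 1) := by
    rw [e]; exact hi1.add (h2.const_mul _)
  rw [← ofReal_integral_eq_lintegral_ofReal hi (Filter.Eventually.of_forall fun x => sq_nonneg _),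
    ← ENNReal.ofReal_add (sq_nonneg _) (sq_nonneg _), e, integral_add hi1 (h2.const_mul _),
    integral_add (integrable_const _) (h1.const_mul _), integral_const_mul, integral_const_mul,
    hsq, integral_id_gaussianReal]
  simp

/-- Change of measure under a predictable shift of a Gaussian sequence. -/
theorem lintegral_gaussianSeq_shift : ∀ {T : ℕ} {c : Fin T → (Fin T → ℝ) → ℝ},
    IsPredictable c → (∀ t, Measurable (c t)) → ∀ {G : (Fin T → ℝ) → ℝ≥0∞}, Measurable G →
    ∫⁻ w, G w ∂gaussianSeq T =
      ∫⁻ w, G (fun t => w t - c t w) *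
        ENNReal.ofReal (Real.exp (∑ t, (c t w * w t - c t w ^ 2 / 2))) ∂gaussianSeq T
  | 0, c, _, _, G, _ => by
    refine lintegral_congr fun w => ?_
    simp only [Finset.univ_eq_empty, Finset.sum_empty, Real.exp_zero, ENNReal.ofReal_one, mul_one]
    congr 1
    exact Subsingleton.elim _ _
  | T + 1, c, hc, hm, G, hG => by
    have hcm (a : ℝ) : Measurable fun w : Fin T → ℝ => (Fin.cons a w : Fin (T + 1) → ℝ) :=
      measurable_finCons.comp measurable_prodMk_left
    rw [lintegral_gaussianSeq_succ hG, lintegral_gaussianSeq_succ (by fun_prop)]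
    -- Nothing precedes the first coordinate, so its shift is the constant `c 0 0`. Once that
    -- coordinate is fixed, the remaining shifts are again predictable.
    refine (lintegral_gaussianReal_shift
      (Measurable.lintegral_prod_right' (hG.comp measurable_finCons)) (c 0 0)).trans ?_
    refine lintegral_congr fun a => ?_
    simp only [Function.comp_apply]
    rw [lintegral_gaussianSeq_shift (G := fun w => G (Fin.cons (a - c 0 0) w)) (hc.cons a) (fun t => (hm _).comp (hcm a))
      (hG.comp (hcm (a - c 0 0))), ← lintegral_mul_const]
    · refine lintegral_congr fun w => ?_
      rw [mul_assoc, ← ENNReal.ofReal_mul (Real.exp_nonneg _), ← Real.exp_add, Fin.sum_univ_succ,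
        hc.zero_eq (Fin.cons a w)]
      congr 2
      · ext i
        induction i using Fin.cases with
        | zero => simp [hc.zero_eq (Fin.cons a w)]
        | succ j => simp
      · simp only [Fin.cons_zero, Fin.cons_succ]
        congr 1
        ring
    · have hS : ∀ t : Fin T, Measurable fun w : Fin T → ℝ => c t.succ (Fin.cons a w) :=
        fun t => (hm _).comp (hcm a)
      refine Measurable.mul ((hG.comp (hcm _)).comp ?_) (by fun_prop)
      exact measurable_pi_iff.2 fun t => (measurable_pi_apply t).sub (hS t)

/-- Orthogonality of the increments of a Gaussian martingale transform. -/
theorem lintegral_gaussianSeq_sq : ∀ {T : ℕ} {c : Fin T → (Fin T → ℝ) → ℝ},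
    IsPredictable c → (∀ t, Measurable (c t)) → ∀ b : ℝ,
    ∫⁻ w, ENNReal.ofReal ((b + ∑ t, c t w * w t) ^ 2) ∂gaussianSeq T =
      ENNReal.ofReal (b ^ 2) + ∫⁻ w, ENNReal.ofReal (∑ t, c t w ^ 2) ∂gaussianSeq T
  | 0, c, _, _, b => by simp
  | T + 1, c, hc, hm, b => by
    have hcm (a : ℝ) : Measurable fun w : Fin T → ℝ => (Fin.cons a w : Fin (T + 1) → ℝ) :=
      measurable_finCons.comp measurable_prodMk_left
    rw [lintegral_gaussianSeq_succ (by fun_prop), lintegral_gaussianSeq_succ (by fun_prop)]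
    have hM : Measurable fun p : ℝ × (Fin T → ℝ) =>
        ENNReal.ofReal (∑ t : Fin T, c t.succ (Fin.cons p.1 p.2) ^ 2) :=
      (Finset.measurable_sum _ fun t _ =>
        ((hm t.succ).comp measurable_finCons).pow_const 2).ennreal_ofReal
    have e1 : ∀ a, ∫⁻ w, ENNReal.ofReal ((b + ∑ t, c t (Fin.cons a w) *
        (Fin.cons a w : Fin (T + 1) → ℝ) t) ^ 2) ∂gaussianSeq T =
        ENNReal.ofReal ((b + c 0 0 * a) ^ 2) +
          ∫⁻ w, ENNReal.ofReal (∑ t : Fin T, c t.succ (Fin.cons a w) ^ 2) ∂gaussianSeq T := by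
      intro a
      -- The free constant `b` serves the induction: it absorbs the first increment `c 0 0 * a`.
      rw [← lintegral_gaussianSeq_sq (hc.cons a) (fun t => (hm _).comp (hcm a))]
      refine lintegral_congr fun w => ?_
      rw [Fin.sum_univ_succ, hc.zero_eq]
      simp only [Fin.cons_zero, Fin.cons_succ, add_assoc]
    have e2 : ∀ a, ∫⁻ w, ENNReal.ofReal (∑ t, c t (Fin.cons a w) ^ 2) ∂gaussianSeq T =
        ENNReal.ofReal (c 0 0 ^ 2) +
          ∫⁻ w, ENNReal.ofReal (∑ t : Fin T, c t.succ (Fin.cons a w) ^ 2) ∂gaussianSeq T := by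
      intro a
      have : ∀ w, ENNReal.ofReal (∑ t, c t (Fin.cons a w) ^ 2) = ENNReal.ofReal (c 0 0 ^ 2) +
          ENNReal.ofReal (∑ t : Fin T, c t.succ (Fin.cons a w) ^ 2) := by
        intro w
        rw [Fin.sum_univ_succ, hc.zero_eq, ENNReal.ofReal_add (sq_nonneg _)
          (Finset.sum_nonneg fun _ _ => sq_nonneg _)]
      simp only [this]
      rw [lintegral_add_left measurable_const]
      simp
    simp only [e1, e2]
    rw [lintegral_add_left (by fun_prop), lintegral_add_left measurable_const,
      lintegral_gaussianReal_sq]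
    simp [add_assoc]

/-- By `exp y ≥ 1 + y`, the nontrivial case reduces to `1 + S + S² = (S + 1/2)² + 3/4`. The error
`S² + Q/2` has a computable mean, so no bound on the likelihood ratio is needed. -/
theorem min_one_exp_ge (S : ℝ) {Q : ℝ} (hQ : 0 ≤ Q) :
    3 / 4 ≤ min 1 (Real.exp (S - Q / 2)) + S ^ 2 + Q / 2 := by
  have h := Real.add_one_le_exp (S - Q / 2)
  rcases min_cases 1 (Real.exp (S - Q / 2)) with ⟨h1, _⟩ | ⟨h1, _⟩ <;> rw [h1] <;>
    nlinarith [sq_nonneg (S + 1 / 2), sq_nonneg S]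

/-- Two-point lower bound: if the two losses cannot both be small on the same data, then the sum of
their expectations under the two Gaussian experiments is bounded below in terms of the expected
squared shift. -/
theorem two_point_bound {T : ℕ} {c : Fin T → (Fin T → ℝ) → ℝ} (hc : IsPredictable c)
    (hm : ∀ t, Measurable (c t)) {F0 F1 : (Fin T → ℝ) → ℝ≥0∞} (h0 : Measurable F0)
    (h1 : Measurable F1) {B : ℝ≥0∞} (hB : ∀ w, B ≤ F0 w + F1 (fun t => w t - c t w)) :
    B * ENNReal.ofReal (3 / 4) ≤ ∫⁻ w, F0 w ∂gaussianSeq T + ∫⁻ w, F1 w ∂gaussianSeq T +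
      B * (ENNReal.ofReal (3 / 2) * ∫⁻ w, ENNReal.ofReal (∑ t, c t w ^ 2) ∂gaussianSeq T) := by
  set S : (Fin T → ℝ) → ℝ := fun w => ∑ t, c t w * w t with hS
  set Q : (Fin T → ℝ) → ℝ := fun w => ∑ t, c t w ^ 2 with hQ
  have hSm : Measurable S := by fun_prop
  have hQm : Measurable Q := by fun_prop
  have hQ0 : ∀ w, 0 ≤ Q w := fun w => Finset.sum_nonneg fun _ _ => sq_nonneg _
  set L : (Fin T → ℝ) → ℝ := fun w => Real.exp (S w - Q w / 2) with hL
  have hsq : ∫⁻ w, ENNReal.ofReal (S w ^ 2) ∂gaussianSeq T =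
      ∫⁻ w, ENNReal.ofReal (Q w) ∂gaussianSeq T := by
    simpa using lintegral_gaussianSeq_sq hc hm 0
  -- `L` is the likelihood ratio of the second experiment to the first on the same data. Weighting
  -- both losses by `min 1 L` underestimates their weights `1` and `L`, and leaves the factor `B`.
  -- After integration `S²` and `Q` have equal means, whence the constant `1 + 1/2 = 3/2`.
  have key : ∀ w, B * ENNReal.ofReal (3 / 4) ≤
      (F0 w + F1 (fun t => w t - c t w) * ENNReal.ofReal (L w)) +
        B * (ENNReal.ofReal (S w ^ 2) + ENNReal.ofReal (1 / 2) * ENNReal.ofReal (Q w)) := by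
    intro w
    have hmin : B * ENNReal.ofReal (min 1 (L w)) ≤
        F0 w + F1 (fun t => w t - c t w) * ENNReal.ofReal (L w) := by
      calc B * ENNReal.ofReal (min 1 (L w))
          ≤ (F0 w + F1 (fun t => w t - c t w)) * ENNReal.ofReal (min 1 (L w)) := by
            gcongr; exact hB w
        _ = F0 w * ENNReal.ofReal (min 1 (L w)) +
            F1 (fun t => w t - c t w) * ENNReal.ofReal (min 1 (L w)) := add_mul _ _ _
        _ ≤ F0 w * 1 + F1 (fun t => w t - c t w) * ENNReal.ofReal (L w) := by
            gcongr
            · exact ENNReal.ofReal_le_one.2 (min_le_left _ _)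
            · exact min_le_right _ _
        _ = _ := by rw [mul_one]
    refine le_trans ?_ (add_le_add_left hmin _)
    rw [← mul_add, ← ENNReal.ofReal_mul (by norm_num),
      ← ENNReal.ofReal_add (sq_nonneg _) (by linarith [hQ0 w]),
      ← ENNReal.ofReal_add (le_min zero_le_one (Real.exp_nonneg _))
        (by nlinarith [hQ0 w, sq_nonneg (S w)])]
    gcongr
    linarith [min_one_exp_ge (S w) (hQ0 w)]
  have hexp : ∀ w, ∑ t, (c t w * w t - c t w ^ 2 / 2) = S w - Q w / 2 := by
    intro w
    rw [Finset.sum_sub_distrib, ← Finset.sum_div]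
  have hF1 := lintegral_gaussianSeq_shift hc hm h1
  simp only [hexp] at hF1
  have hint := lintegral_mono (μ := gaussianSeq T) key
  rw [lintegral_const, measure_univ, mul_one, lintegral_add_right _ (by fun_prop),
    lintegral_add_left h0, ← hF1, lintegral_const_mul _ (by fun_prop),
    lintegral_add_left (by fun_prop), hsq, lintegral_const_mul _ (by fun_prop)] at hint
  refine hint.trans_eq ?_
  congr 2
  change _ = ENNReal.ofReal (3 / 2) * ∫⁻ w, ENNReal.ofReal (Q w) ∂gaussianSeq T
  nth_rewrite 1 [← one_mul (∫⁻ w, ENNReal.ofReal (Q w) ∂gaussianSeq T)]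
  rw [← add_mul, ← ENNReal.ofReal_one, ← ENNReal.ofReal_add (by norm_num) (by norm_num)]
  norm_num

/-! ### Measurability and causality of trajectories, Gaussian noise along a line -/

section History

variable {K m n T : ℕ} {U : Type*} [MeasurableSpace U]

theorem measurable_finSnoc {α : Type*} [MeasurableSpace α] {t : ℕ} :
    Measurable fun p : (Fin t → α) × α => (Fin.snoc p.1 p.2 : Fin (t + 1) → α) := by
  refine measurable_pi_iff.2 fun i => ?_
  refine Fin.lastCases ?_ (fun j => ?_) i
  · simpa using measurable_snd
  · simpa [Function.comp_def] using (measurable_pi_apply j).comp measurable_fst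

theorem measurable_response (q : Matrix (Fin m) (Fin n) ℝ × EuclideanSpace ℝ (Fin m)) :
    Measurable (response q) := by
  have : Continuous (response q) := by
    unfold response
    refine Continuous.add ?_ continuous_const
    exact (PiLp.continuous_toLp 2 _).comp
      (Continuous.matrix_mulVec continuous_const (PiLp.continuous_ofLp 2 _))
  exact this.measurable

theorem measurable_history (θ : Param K m n) (μ : CausalRule K m n U) : ∀ (t : ℕ) (h : t ≤ T),
    Measurable fun ω : U × (Fin (T + 1) → Fin K) × (Fin T → EuclideanSpace ℝ (Fin m)) =>
      history θ μ ω.1 ω.2.1 ω.2.2 t h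
  | 0, h => by
    simp only [history]
    refine measurable_const.prodMk (measurable_const.prodMk ?_)
    exact measurable_pi_iff.2 fun _ => (measurable_pi_apply _).comp
      (measurable_fst.comp measurable_snd)
  | t + 1, h => by
    have ih := measurable_history θ μ t (Nat.le_of_succ_le h)
    have hx : Measurable fun ω : U × (Fin (T + 1) → Fin K) ×
        (Fin T → EuclideanSpace ℝ (Fin m)) =>
        μ.toFun t (ω.1, history θ μ ω.1 ω.2.1 ω.2.2 t (Nat.le_of_succ_le h)) :=
      (μ.measurable_toFun t).comp (measurable_fst.prodMk ih)
    have hj : Measurable fun ω : U × (Fin (T + 1) → Fin K) ×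
        (Fin T → EuclideanSpace ℝ (Fin m)) => ω.2.1 ⟨t + 1, Nat.lt_succ_of_le h⟩ :=
      (measurable_pi_apply _).comp (measurable_fst.comp measurable_snd)
    have hw : Measurable fun ω : U × (Fin (T + 1) → Fin K) ×
        (Fin T → EuclideanSpace ℝ (Fin m)) => ω.2.2 ⟨t, h⟩ :=
      (measurable_pi_apply _).comp (measurable_snd.comp measurable_snd)
    have hr : Measurable fun p : EuclideanSpace ℝ (Fin n) × Fin K => response (θ p.2) p.1 :=
      measurable_from_prod_countable_left fun j => measurable_response (θ j)
    simp only [history]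
    refine Measurable.prodMk (measurable_finSnoc.comp (ih.fst.prodMk hx)) (Measurable.prodMk
      (measurable_finSnoc.comp (ih.snd.fst.prodMk ?_))
      (measurable_finSnoc.comp (ih.snd.snd.prodMk hj)))
    exact (hr.comp (hx.prodMk hj)).add hw

/-- Non-anticipation; it makes the shift between two systems predictable. -/
theorem history_congr (θ : Param K m n) (μ : CausalRule K m n U) (u : U)
    (s : Fin (T + 1) → Fin K) {w w' : Fin T → EuclideanSpace ℝ (Fin m)} :
    ∀ (t : ℕ) (h : t ≤ T), (∀ i : Fin T, i.1 < t → w i = w' i) →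
      history θ μ u s w t h = history θ μ u s w' t h
  | 0, _, _ => rfl
  | t + 1, h, hw => by
    have ih := history_congr θ μ u s t (Nat.le_of_succ_le h) fun i hi => hw i (by omega)
    simp only [history, ih, hw ⟨t, h⟩ (Nat.lt_succ_self t)]

/-- Two systems generate the same data if the noise compensates the difference of the
responses. -/
theorem history_eq_of_compensated {θ θ' : Param K m n} (μ : CausalRule K m n U) (u : U)
    (s : Fin (T + 1) → Fin K) {w w' : Fin T → EuclideanSpace ℝ (Fin m)}
    (hw : ∀ i : Fin T,
      response (θ' (s i.succ)) (μ.toFun i (u, history θ μ u s w i i.2.le)) + w' i =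
        response (θ (s i.succ)) (μ.toFun i (u, history θ μ u s w i i.2.le)) + w i) :
    ∀ (t : ℕ) (h : t ≤ T), history θ' μ u s w' t h = history θ μ u s w t h
  | 0, _ => rfl
  | t + 1, h => by
    have ih := history_eq_of_compensated μ u s hw t (Nat.le_of_succ_le h)
    have h1 := hw ⟨t, h⟩
    simp only [Fin.succ_mk] at h1
    simp only [history, ih, h1]

/-- The law of `g • r` for a standard Gaussian variable `g`. -/
noncomputable def lineGaussian (r : EuclideanSpace ℝ (Fin m)) :
    Measure (EuclideanSpace ℝ (Fin m)) :=
  (gaussianReal 0 1).map fun g => g • r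

instance (r : EuclideanSpace ℝ (Fin m)) : IsProbabilityMeasure (lineGaussian r) :=
  Measure.isProbabilityMeasure_map (by fun_prop)

/-- Conditioning on the seed and the state path leaves a scalar Gaussian sequence as the only
randomness, to which the two-point inequality applies. -/
theorem lintegral_systemLaw_lineGaussian (ρ : Measure U) [IsProbabilityMeasure ρ] (π : Fin K → ℝ)
    (P : Matrix (Fin K) (Fin K) ℝ) (r : EuclideanSpace ℝ (Fin m))
    {F : U × (Fin (T + 1) → Fin K) × (Fin T → EuclideanSpace ℝ (Fin m)) → ℝ≥0∞}
    (hF : Measurable F) :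
    ∫⁻ ω, F ω ∂systemLaw T ρ π P (fun _ => lineGaussian r) =
      ∑ s, ENNReal.ofReal (pathProb π P s) *
        ∫⁻ u, ∫⁻ g, F (u, s, fun t => g t • r) ∂gaussianSeq T ∂ρ := by
  rw [systemLaw, lintegral_finsetSum_measure]
  refine Finset.sum_congr rfl fun s _ => ?_
  rw [lintegral_smul_measure, smul_eq_mul]
  congr 1
  have hpi : (Measure.pi fun _ : Fin T => lineGaussian r) =
      (gaussianSeq T).map fun g t => g t • r := by
    have : ∀ _ : Fin T, SigmaFinite ((gaussianReal 0 1).map fun g : ℝ => g • r) := fun _ =>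
      inferInstanceAs (SigmaFinite (lineGaussian r))
    exact (Measure.pi_map_pi (μ := fun _ : Fin T => gaussianReal 0 1)
      (f := fun _ g => g • r) fun _ => by fun_prop).symm
  rw [lintegral_prod _ hF.aemeasurable]
  refine lintegral_congr fun u => ?_
  have hu : Measurable fun p : (Fin (T + 1) → Fin K) × (Fin T → EuclideanSpace ℝ (Fin m)) =>
      F (u, p) := hF.comp measurable_prodMk_left
  have hus : Measurable fun w : Fin T → EuclideanSpace ℝ (Fin m) => F (u, s, w) :=
    hu.comp measurable_prodMk_left
  rw [Measure.dirac_prod, lintegral_map hu measurable_prodMk_left, hpi,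
    lintegral_map hus (by fun_prop)]

theorem pathProb_nonneg {π : Fin K → ℝ} (hπ : π ∈ stdSimplex ℝ (Fin K))
    (s : Fin (T + 1) → Fin K) :
    0 ≤ pathProb π (Matrix.of fun _ _ => (K : ℝ)⁻¹) s :=
  mul_nonneg (hπ.1 _) (Finset.prod_nonneg fun _ _ => by simp)

theorem sum_pathProb_uniform (hK : 0 < K) {π : Fin K → ℝ} (hπ : π ∈ stdSimplex ℝ (Fin K)) :
    ∑ s : Fin (T + 1) → Fin K,
      ENNReal.ofReal (pathProb π (Matrix.of fun _ _ => (K : ℝ)⁻¹) s) = 1 := by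
  rw [← ENNReal.ofReal_sum_of_nonneg fun s _ => pathProb_nonneg hπ s, ENNReal.ofReal_eq_one]
  rw [← (Fin.consEquiv fun _ : Fin (T + 1) => Fin K).sum_comp, Fintype.sum_prod_type]
  have hK' : (K : ℝ) ≠ 0 := by positivity
  simp only [pathProb, Fin.consEquiv, Equiv.coe_fn_mk, Fin.cons_zero, of_apply,
    Finset.prod_const, Finset.card_univ, Fintype.card_fin, Finset.sum_const, Fintype.card_pi,
    nsmul_eq_mul, Nat.cast_pow, inv_pow]
  rw [← Finset.mul_sum, ← Finset.sum_mul, hπ.2]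
  field_simp

end History

/-! ### Lower bounds for the error of two systems on common data -/

section TwoPoint

variable {K m n T : ℕ} {U : Type*} [MeasurableSpace U]

/-- The sum of the squared errors when the seed is `u`, the states are `s` and the noise of
period `t + 1` is `g t • r`. -/
noncomputable def lineError (μ est : CausalRule K m n U) (θ : Param K m n)
    (r : EuclideanSpace ℝ (Fin m)) (x : EuclideanSpace ℝ (Fin n)) (s : Fin (T + 1) → Fin K)
    (u : U) (g : Fin T → ℝ) : ℝ≥0∞ :=
  ∑ t : Fin T, ‖est.toFun t (u, history θ μ u s (fun t => g t • r) t t.2.le) - x‖ₑ ^ 2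

theorem measurable_lineInput (μ est : CausalRule K m n U) (θ : Param K m n)
    (r : EuclideanSpace ℝ (Fin m)) (s : Fin (T + 1) → Fin K) (t : Fin T) :
    Measurable fun p : U × (Fin T → ℝ) =>
      est.toFun t (p.1, history θ μ p.1 s (fun t => p.2 t • r) t t.2.le) := by
  refine (est.measurable_toFun t).comp (measurable_fst.prodMk
    ((measurable_history θ μ t t.2.le).comp (g := fun ω : U × (Fin (T + 1) → Fin K) ×
      (Fin T → EuclideanSpace ℝ (Fin m)) => history θ μ ω.1 ω.2.1 ω.2.2 t t.2.le)
      (f := fun p : U × (Fin T → ℝ) => (p.1, s, fun t => p.2 t • r)) ?_))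
  fun_prop

theorem measurable_lineError_uncurry (μ est : CausalRule K m n U) (θ : Param K m n)
    (r : EuclideanSpace ℝ (Fin m)) (x : EuclideanSpace ℝ (Fin n)) (s : Fin (T + 1) → Fin K) :
    Measurable fun p : U × (Fin T → ℝ) => lineError μ est θ r x s p.1 p.2 :=
  Finset.measurable_sum _ fun t _ =>
    ((measurable_lineInput μ est θ r s t).sub_const x).enorm.pow_const 2

theorem measurable_lineError (μ est : CausalRule K m n U) (θ : Param K m n)
    (r : EuclideanSpace ℝ (Fin m)) (x : EuclideanSpace ℝ (Fin n)) (s : Fin (T + 1) → Fin K)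
    (u : U) : Measurable fun g : Fin T → ℝ => lineError μ est θ r x s u g := by
  have h := (measurable_lineError_uncurry μ est θ r x s).comp (measurable_prodMk_left (x := u))
  simpa only [Function.comp_def] using h

theorem measurable_lintegral_lineError (μ est : CausalRule K m n U) (θ : Param K m n)
    (r : EuclideanSpace ℝ (Fin m)) (x : EuclideanSpace ℝ (Fin n)) (s : Fin (T + 1) → Fin K) :
    Measurable fun u => ∫⁻ g, lineError μ est θ r x s u g ∂gaussianSeq T :=
  (measurable_lineError_uncurry μ est θ r x s).lintegral_prod_right'

theorem cumulativeMSE_eq {ystar : EuclideanSpace ℝ (Fin m)} (ρ : Measure U)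
    [IsProbabilityMeasure ρ] (π : Fin K → ℝ) (μ est : CausalRule K m n U) {θ : Param K m n}
    {P : Matrix (Fin K) (Fin K) ℝ} (r : EuclideanSpace ℝ (Fin m))
    {x : EuclideanSpace ℝ (Fin n)} (hx : ∀ i, optimalInput ystar θ P i = x) :
    cumulativeMSE T ystar ρ π μ est θ P (fun _ => lineGaussian r) =
      ∑ s, ENNReal.ofReal (pathProb π P s) *
        ∫⁻ u, ∫⁻ g, lineError μ est θ r x s u g ∂gaussianSeq T ∂ρ := by
  simp only [cumulativeMSE, hx]
  refine lintegral_systemLaw_lineGaussian ρ π P r ?_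
  refine Finset.measurable_sum _ fun t _ => Measurable.pow_const (Measurable.enorm ?_) 2
  exact ((est.measurable_toFun t).comp
    (measurable_fst.prodMk (measurable_history θ μ t t.2.le))).sub_const x

theorem enorm_sub_sq_add_ge (a x y : EuclideanSpace ℝ (Fin n)) :
    ENNReal.ofReal (‖x - y‖ ^ 2 / 2) ≤ ‖a - x‖ₑ ^ 2 + ‖a - y‖ₑ ^ 2 := by
  simp only [← ofReal_norm, ← ENNReal.ofReal_pow (norm_nonneg _)]
  rw [← ENNReal.ofReal_add (by positivity) (by positivity)]
  refine ENNReal.ofReal_le_ofReal ?_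
  have h : ‖x - y‖ ≤ ‖a - x‖ + ‖a - y‖ := by
    have := norm_sub_le (a - y) (a - x)
    rw [sub_sub_sub_cancel_left] at this
    linarith
  nlinarith [norm_nonneg (x - y), sq_nonneg (‖a - x‖ - ‖a - y‖)]

variable {θ θ' : Param K m n} {r : EuclideanSpace ℝ (Fin m)} {x x' : EuclideanSpace ℝ (Fin n)}
  {φ : Fin K → EuclideanSpace ℝ (Fin n) → ℝ} {M : ℝ}

/-- The two-point inequality for a fixed seed and state path. The shift is `φ` evaluated at the
input chosen under `θ`, so `hφM` bounds the sum of its squares by `M` times the input error under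
`θ`. -/
theorem lintegral_lineError_add_ge (μ est : CausalRule K m n U) (hφ : ∀ j, Measurable (φ j))
    (hresp : ∀ j z, response (θ' j) z = response (θ j) z + φ j z • r) (hM : 0 ≤ M)
    (hφM : ∀ j z, φ j z ^ 2 ≤ M * ‖z - x‖ ^ 2) (s : Fin (T + 1) → Fin K) (u : U) :
    T * ENNReal.ofReal (‖x - x'‖ ^ 2 / 2) * ENNReal.ofReal (3 / 4) ≤
      ∫⁻ g, lineError μ est θ r x s u g ∂gaussianSeq T +
        ∫⁻ g, lineError μ est θ' r x' s u g ∂gaussianSeq T +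
        T * ENNReal.ofReal (‖x - x'‖ ^ 2 / 2) * (ENNReal.ofReal (3 / 2) * (ENNReal.ofReal M *
          ∫⁻ g, lineError μ μ θ r x s u g ∂gaussianSeq T)) := by
  set c : Fin T → (Fin T → ℝ) → ℝ := fun t g =>
    φ (s t.succ) (μ.toFun t (u, history θ μ u s (fun t => g t • r) t t.2.le)) with hc
  have hpred : IsPredictable c := by
    intro t g g' h
    simp only [hc]
    rw [history_congr θ μ u s t t.2.le fun i hi => by rw [h i hi]]
  have hcm : ∀ t, Measurable (c t) := fun t =>
    (hφ _).comp ((measurable_lineInput μ μ θ r s t).comp measurable_prodMk_left)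
  -- The extra response `φ • r` of `θ'` is cancelled by lowering the noise by `c`, so the estimates
  -- coincide and cannot be close to both `x` and `x'`.
  have hhist : ∀ (g : Fin T → ℝ) (t : ℕ) (h : t ≤ T),
      history θ' μ u s (fun t => (g t - c t g) • r) t h =
        history θ μ u s (fun t => g t • r) t h := by
    intro g
    refine history_eq_of_compensated μ u s fun i => ?_
    rw [hresp, sub_smul]
    simp only [hc]
    abel
  refine (two_point_bound hpred hcm (measurable_lineError μ est θ r x s u)
    (measurable_lineError μ est θ' r x' s u) (B := T * ENNReal.ofReal (‖x - x'‖ ^ 2 / 2))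
    fun g => ?_).trans ?_
  · simp only [lineError, hhist]
    rw [← Finset.sum_add_distrib]
    calc T * ENNReal.ofReal (‖x - x'‖ ^ 2 / 2)
        = ∑ _ : Fin T, ENNReal.ofReal (‖x - x'‖ ^ 2 / 2) := by simp
      _ ≤ _ := Finset.sum_le_sum fun t _ => enorm_sub_sq_add_ge _ _ _
  · gcongr
    rw [← lintegral_const_mul _ (measurable_lineError μ μ θ r x s u)]
    refine lintegral_mono fun g => ?_
    rw [lineError, ENNReal.ofReal_sum_of_nonneg fun _ _ => sq_nonneg _, Finset.mul_sum]
    refine Finset.sum_le_sum fun t _ => ?_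
    rw [← ofReal_norm, ← ENNReal.ofReal_pow (norm_nonneg _), ← ENNReal.ofReal_mul hM]
    exact ENNReal.ofReal_le_ofReal (hφM _ _)

/-- Under the uniform transition matrix, two systems whose responses differ by `φ j x • r` with
`φ j x ^ 2 ≤ M * ‖x - x₀‖ ^ 2`, where `x₀` is the optimal input of the first, cannot both have
accurately estimated optimal inputs unless the inputs deviate from `x₀`. -/
theorem cumulativeMSE_add_ge (hK : 0 < K) {ystar : EuclideanSpace ℝ (Fin m)} (ρ : Measure U)
    [IsProbabilityMeasure ρ] {π : Fin K → ℝ} (hπ : π ∈ stdSimplex ℝ (Fin K))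
    (μ est : CausalRule K m n U)
    (hx : ∀ i, optimalInput ystar θ (Matrix.of fun _ _ => (K : ℝ)⁻¹) i = x)
    (hx' : ∀ i, optimalInput ystar θ' (Matrix.of fun _ _ => (K : ℝ)⁻¹) i = x')
    (hφ : ∀ j, Measurable (φ j))
    (hresp : ∀ j z, response (θ' j) z = response (θ j) z + φ j z • r) (hM : 0 ≤ M)
    (hφM : ∀ j z, φ j z ^ 2 ≤ M * ‖z - x‖ ^ 2) :
    T * ENNReal.ofReal (‖x - x'‖ ^ 2 / 2) * ENNReal.ofReal (3 / 4) ≤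
      cumulativeMSE T ystar ρ π μ est θ (Matrix.of fun _ _ => (K : ℝ)⁻¹)
          (fun _ => lineGaussian r) +
        cumulativeMSE T ystar ρ π μ est θ' (Matrix.of fun _ _ => (K : ℝ)⁻¹)
          (fun _ => lineGaussian r) +
        T * ENNReal.ofReal (‖x - x'‖ ^ 2 / 2) * (ENNReal.ofReal (3 / 2) * (ENNReal.ofReal M *
          cumulativeMSE T ystar ρ π μ μ θ (Matrix.of fun _ _ => (K : ℝ)⁻¹)
            (fun _ => lineGaussian r))) := by
  rw [cumulativeMSE_eq ρ π μ est r hx, cumulativeMSE_eq ρ π μ est r hx',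
    cumulativeMSE_eq ρ π μ μ r hx]
  have key := fun s : Fin (T + 1) → Fin K => lintegral_mono (μ := ρ)
    (lintegral_lineError_add_ge (x' := x') μ est hφ hresp hM hφM s)
  have hm := measurable_lintegral_lineError (T := T) μ μ θ r x
  have hm0 := measurable_lintegral_lineError (T := T) μ est θ r x
  replace key : ∀ s : Fin (T + 1) → Fin K,
      T * ENNReal.ofReal (‖x - x'‖ ^ 2 / 2) * ENNReal.ofReal (3 / 4) ≤
        ∫⁻ u, ∫⁻ g, lineError μ est θ r x s u g ∂gaussianSeq T ∂ρ +
          ∫⁻ u, ∫⁻ g, lineError μ est θ' r x' s u g ∂gaussianSeq T ∂ρ +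
          T * ENNReal.ofReal (‖x - x'‖ ^ 2 / 2) * (ENNReal.ofReal (3 / 2) * (ENNReal.ofReal M *
            ∫⁻ u, ∫⁻ g, lineError μ μ θ r x s u g ∂gaussianSeq T ∂ρ)) := by
    intro s
    have h := key s
    rwa [lintegral_const, measure_univ, mul_one,
      lintegral_add_right _ (((hm s).const_mul _).const_mul _ |>.const_mul _),
      lintegral_add_left (hm0 s), lintegral_const_mul _ (((hm s).const_mul _).const_mul _),
      lintegral_const_mul _ ((hm s).const_mul _), lintegral_const_mul _ (hm s)] at h
  rw [← one_mul (T * ENNReal.ofReal (‖x - x'‖ ^ 2 / 2) * ENNReal.ofReal (3 / 4)),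
    ← sum_pathProb_uniform (T := T) hK hπ, Finset.sum_mul]
  refine (Finset.sum_le_sum fun s _ => mul_le_mul_right (key s) _).trans_eq ?_
  simp only [Finset.mul_sum, ← Finset.sum_add_distrib]
  refine Finset.sum_congr rfl fun s _ => ?_
  ring

theorem le_lineError (hT : 0 < T) (μ est : CausalRule K m n U) (θ : Param K m n)
    (r : EuclideanSpace ℝ (Fin m)) (x : EuclideanSpace ℝ (Fin n)) (s : Fin (T + 1) → Fin K)
    (u : U) (g : Fin T → ℝ) :
    ‖est.toFun 0 (u, (Fin.elim0, Fin.elim0, fun _ => s 0)) - x‖ₑ ^ 2 ≤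
      lineError μ est θ r x s u g := by
  unfold lineError
  refine le_trans (le_of_eq ?_) (Finset.single_le_sum (fun _ _ => zero_le)
    (Finset.mem_univ (⟨0, hT⟩ : Fin T)))
  rfl

/-- A bound that does not depend on the data: nothing is observed before the first decision. -/
theorem cumulativeMSE_add_ge_of_pos (hK : 0 < K) {ystar : EuclideanSpace ℝ (Fin m)} (ρ : Measure U)
    [IsProbabilityMeasure ρ] {π : Fin K → ℝ} (hπ : π ∈ stdSimplex ℝ (Fin K)) (hT : 0 < T)
    (μ est : CausalRule K m n U) (r : EuclideanSpace ℝ (Fin m))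
    (hx : ∀ i, optimalInput ystar θ (Matrix.of fun _ _ => (K : ℝ)⁻¹) i = x)
    (hx' : ∀ i, optimalInput ystar θ' (Matrix.of fun _ _ => (K : ℝ)⁻¹) i = x') :
    ENNReal.ofReal (‖x - x'‖ ^ 2 / 2) ≤
      cumulativeMSE T ystar ρ π μ est θ (Matrix.of fun _ _ => (K : ℝ)⁻¹)
          (fun _ => lineGaussian r) +
        cumulativeMSE T ystar ρ π μ est θ' (Matrix.of fun _ _ => (K : ℝ)⁻¹)
          (fun _ => lineGaussian r) := by
  have key : ∀ (s : Fin (T + 1) → Fin K) u g, ENNReal.ofReal (‖x - x'‖ ^ 2 / 2) ≤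
      lineError μ est θ r x s u g + lineError μ est θ' r x' s u g := by
    intro s u g
    refine (enorm_sub_sq_add_ge (est.toFun 0 (u, (Fin.elim0, Fin.elim0, fun _ => s 0)))
      x x').trans ?_
    exact add_le_add (le_lineError hT μ est θ r x s u g) (le_lineError hT μ est θ' r x' s u g)
  rw [cumulativeMSE_eq ρ π μ est r hx, cumulativeMSE_eq ρ π μ est r hx',
    ← one_mul (ENNReal.ofReal (‖x - x'‖ ^ 2 / 2)), ← sum_pathProb_uniform (T := T) hK hπ,
    Finset.sum_mul, ← Finset.sum_add_distrib]
  refine Finset.sum_le_sum fun s _ => ?_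
  rw [← mul_add, ← lintegral_add_left (measurable_lintegral_lineError μ est θ r x s)]
  refine mul_le_mul_right ?_ _
  rw [← mul_one (ENNReal.ofReal _), ← measure_univ (μ := ρ), ← lintegral_const]
  refine lintegral_mono fun u => ?_
  rw [← lintegral_add_left (measurable_lineError μ est θ r x s u),
    ← mul_one (ENNReal.ofReal _), ← measure_univ (μ := gaussianSeq T), ← lintegral_const]
  exact lintegral_mono fun g => key s u g

end TwoPoint

/-! ### Admissibility of small Gaussian noise -/

section Noise

theorem lintegral_gaussianReal_pow_lt_top {k : ℕ} (hk : k ≠ 0) :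
    ∫⁻ g, ‖g‖ₑ ^ k ∂gaussianReal 0 1 < ∞ := by
  have h : MemLp (fun x : ℝ => x) k (gaussianReal 0 1) := memLp_id_gaussianReal (k : NNReal)
  have h2 := lintegral_rpow_enorm_lt_top_of_eLpNorm_lt_top (by simpa using hk)
    (ENNReal.natCast_ne_top k) h.2
  simpa using h2

/-- A Gaussian noise of small intensity along a line is a noise law. -/
theorem exists_isNoiseLaw_lineGaussian {σ : ℝ} (hσ : 0 < σ) (m : ℕ) :
    ∃ τ : ℝ, 0 < τ ∧ ∀ r : EuclideanSpace ℝ (Fin m), ‖r‖ ≤ τ → IsNoiseLaw σ (lineGaussian r) := by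
  set N : ℕ → ℝ := fun k => (∫⁻ g, ‖g‖ₑ ^ k ∂gaussianReal 0 1).toReal with hN
  have hN0 : ∀ k, 0 ≤ N k := fun k => ENNReal.toReal_nonneg
  have hd : 0 < 1 + N 2 + N 4 := by linarith [hN0 2, hN0 4]
  have moment : ∀ k : ℕ, k ≠ 0 → N k ≤ (1 + N 2 + N 4) ^ k →
      ∀ r : EuclideanSpace ℝ (Fin m), ‖r‖ ≤ σ / (1 + N 2 + N 4) → ∀ i,
      ∫⁻ w, ‖w i‖ₑ ^ k ∂lineGaussian r ≤ ENNReal.ofReal (σ ^ k) := by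
    intro k hk hNk r hr i
    rw [lineGaussian, lintegral_map (by fun_prop) (by fun_prop)]
    simp only [PiLp.smul_apply, smul_eq_mul, enorm_mul, mul_pow]
    rw [lintegral_mul_const _ (by fun_prop),
      ← ENNReal.ofReal_toReal (lintegral_gaussianReal_pow_lt_top hk).ne, ← ofReal_norm,
      ← ENNReal.ofReal_pow (norm_nonneg _), ← ENNReal.ofReal_mul ENNReal.toReal_nonneg]
    refine ENNReal.ofReal_le_ofReal ?_
    have h1 : ‖r i‖ ≤ σ / (1 + N 2 + N 4) := (PiLp.norm_apply_le r i).trans hr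
    calc N k * ‖r i‖ ^ k ≤ (1 + N 2 + N 4) ^ k * (σ / (1 + N 2 + N 4)) ^ k := by gcongr
      _ = σ ^ k := by rw [← mul_pow, mul_div_cancel₀ _ hd.ne']
  -- The denominator is at least `1`, so its square dominates `N 2` and its fourth power dominates
  -- `N 4`.
  refine ⟨σ / (1 + N 2 + N 4), by positivity, fun r hr => ⟨inferInstance, ?_, ?_, ?_⟩⟩
  · rw [lineGaussian, integral_map (by fun_prop) (by fun_prop), integral_smul_const,
      integral_id_gaussianReal, zero_smul]
  · refine moment 2 two_ne_zero ?_ r hr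
    nlinarith [hN0 2, hN0 4]
  · refine moment 4 four_ne_zero ?_ r hr
    have h1 : 1 ≤ 1 + N 2 + N 4 := by linarith [hN0 2, hN0 4]
    exact (by linarith [hN0 2] : N 4 ≤ 1 + N 2 + N 4).trans (le_self_pow₀ h1 four_ne_zero)

end Noise

/-! ### The optimal input under uniform transitions -/

section Optimal

variable {K m n : ℕ}

/-- Expresses full column rank as an open condition, which therefore survives small perturbations.
-/
theorem rank_eq_iff_det_gram_ne_zero (A : Matrix (Fin m) (Fin n) ℝ) :
    A.rank = n ↔ (Aᵀ * A).det ≠ 0 := by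
  constructor
  · intro h hdet
    obtain ⟨v, hv, hv0⟩ := exists_mulVec_eq_zero_iff.2 hdet
    have h1 := LinearMap.finrank_range_add_finrank_ker A.mulVecLin
    have h2 : Module.finrank ℝ (LinearMap.range A.mulVecLin) = n := h
    rw [h2, Module.finrank_fin_fun] at h1
    have h3 : LinearMap.ker A.mulVecLin = ⊥ := Submodule.finrank_eq_zero.1 (by omega)
    refine hv (LinearMap.ker_eq_bot'.1 h3 v ?_)
    refine dotProduct_self_eq_zero.1 ?_
    rw [mulVecLin_apply, ← vecMul_transpose, ← dotProduct_mulVec, vecMul_transpose,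
      mulVec_mulVec, hv0, dotProduct_zero]
  · intro h
    rw [← rank_transpose_mul_self, rank_of_isUnit _ ((isUnit_iff_isUnit_det _).2 h.isUnit)]
    simp

/-- The averaged Gram matrix `∑_j A_jᵀ A_j / K`. -/
noncomputable def gram (θ : Param K m n) : Matrix (Fin n) (Fin n) ℝ :=
  ∑ j, (K : ℝ)⁻¹ • ((θ j).1ᵀ * (θ j).1)

/-- Half of the gradient of the expected cost under uniform transitions. -/
noncomputable def halfGradient (ystar : EuclideanSpace ℝ (Fin m)) (θ : Param K m n)
    (x : EuclideanSpace ℝ (Fin n)) : Fin n → ℝ :=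
  ∑ j, (K : ℝ)⁻¹ • ((θ j).1ᵀ *ᵥ ofLp (response (θ j) x - ystar))

theorem det_gram_ne_zero (hK : 0 < K) {θ : Param K m n} (hθ : ∀ k, (θ k).1.rank = n) :
    (gram θ).det ≠ 0 := by
  have hpd : (gram θ).PosDef := by
    have hk : ∀ k, ((K : ℝ)⁻¹ • ((θ k).1ᵀ * (θ k).1)).PosDef := by
      intro k
      refine PosDef.smul ?_ (by positivity)
      refine (PosSemidef.posDef_iff_isUnit ?_).2
        ((isUnit_iff_isUnit_det _).2 ((rank_eq_iff_det_gram_ne_zero _).1 (hθ k)).isUnit)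
      simpa using posSemidef_conjTranspose_mul_self (θ k).1
    have : Nonempty (Fin K) := ⟨⟨0, hK⟩⟩
    exact Finset.sum_induction_nonempty _ PosDef (fun _ _ h₁ h₂ => h₁.add h₂)
      Finset.univ_nonempty fun k _ => hk k
  exact hpd.det_pos.ne'

/-- The cost is quadratic, so one Newton step from any `x` reaches its minimizer. -/
theorem optimalInput_uniform (ystar : EuclideanSpace ℝ (Fin m)) {θ : Param K m n}
    (hdet : (gram θ).det ≠ 0) (x : EuclideanSpace ℝ (Fin n)) (i : Fin K) :
    optimalInput ystar θ (Matrix.of fun _ _ => (K : ℝ)⁻¹) i =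
      x - toLp 2 ((gram θ)⁻¹ *ᵥ halfGradient ystar θ x) := by
  have h : ∑ j, (K : ℝ)⁻¹ • ((θ j).1ᵀ *ᵥ ofLp (ystar - (θ j).2)) =
      gram θ *ᵥ ofLp x - halfGradient ystar θ x := by
    rw [gram, halfGradient, sum_mulVec, ← Finset.sum_sub_distrib]
    refine Finset.sum_congr rfl fun j _ => ?_
    rw [smul_mulVec, ← mulVec_mulVec, ← smul_sub, ← mulVec_sub]
    congr 2
    simp only [response, ofLp_sub, ofLp_add]
    abel
  change toLp 2 ((gram θ)⁻¹ *ᵥ _) = _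
  simp only [of_apply]
  rw [h, mulVec_sub, mulVec_mulVec, nonsing_inv_mul _ hdet.isUnit, one_mulVec]
  simp

theorem halfGradient_eq_zero (ystar : EuclideanSpace ℝ (Fin m)) {θ : Param K m n}
    (hdet : (gram θ).det ≠ 0) {x : EuclideanSpace ℝ (Fin n)} {i : Fin K}
    (hx : optimalInput ystar θ (Matrix.of fun _ _ => (K : ℝ)⁻¹) i = x) :
    halfGradient ystar θ x = 0 := by
  have h := optimalInput_uniform ystar hdet x i
  rw [hx, eq_comm, sub_eq_self, toLp_eq_zero] at h
  have h2 := congrArg (fun v => gram θ *ᵥ v) h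
  simpa [mulVec_mulVec, mul_nonsing_inv _ hdet.isUnit] using h2

/-- An interior model with vanishing residuals can be perturbed to one with a nonzero residual and
the same optimal input. -/
theorem exists_interior_residual_ne_zero (hK : 1 < K) (hn : 0 < n)
    (ystar : EuclideanSpace ℝ (Fin m)) {Θ : Set (Param K m n)} {θ : Param K m n}
    (hθ : θ ∈ interior Θ) (hrank : ∀ k, (θ k).1.rank = n) :
    ∃ θ' ∈ interior Θ, ∃ x k, (∀ k, (θ' k).1.rank = n) ∧ halfGradient ystar θ' x = 0 ∧
      response (θ' k) x - ystar ≠ 0 ∧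
      ∀ i, optimalInput ystar θ (Matrix.of fun _ _ => (K : ℝ)⁻¹) i = x := by
  have hdet := det_gram_ne_zero (by omega) hrank
  set x : EuclideanSpace ℝ (Fin n) :=
    optimalInput ystar θ (Matrix.of fun _ _ => (K : ℝ)⁻¹) ⟨0, by omega⟩ with hx
  have hgrad : halfGradient ystar θ x = 0 := halfGradient_eq_zero ystar hdet hx.symm
  have hopt : ∀ i, optimalInput ystar θ (Matrix.of fun _ _ => (K : ℝ)⁻¹) i = x := fun i => rfl
  by_cases hres : ∃ k, response (θ k) x - ystar ≠ 0
  · obtain ⟨k, hk⟩ := hres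
    exact ⟨θ, hθ, x, k, hrank, hgrad, hk, hopt⟩
  push Not at hres
  obtain ⟨z, hz⟩ : ∃ z : Fin n → ℝ, z ≠ 0 := ⟨Pi.single ⟨0, hn⟩ 1, by simp⟩
  have hG : ∀ k, (θ k).1ᵀ *ᵥ ((θ k).1 *ᵥ (((θ k).1ᵀ * (θ k).1)⁻¹ *ᵥ z)) = z := by
    intro k
    rw [mulVec_mulVec, mulVec_mulVec,
      mul_nonsing_inv _ ((rank_eq_iff_det_gram_ne_zero _).1 (hrank k)).isUnit, one_mulVec]
  set k₀ : Fin K := ⟨0, by omega⟩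
  set k₁ : Fin K := ⟨1, hK⟩
  have h01 : k₀ ≠ k₁ := by simp [k₀, k₁]
  -- The weights `d` sum to zero and `A_kᵀ v_k = d_k z`. Moving `b_k` by `ε v_k` thus keeps the
  -- averaged gradient at zero, while the residual of `k₀` becomes `ε v_{k₀} ≠ 0`.
  set d : Fin K → ℝ := Pi.single k₀ 1 - Pi.single k₁ 1 with hd
  set v : Fin K → Fin m → ℝ := fun k =>
    d k • ((θ k).1 *ᵥ (((θ k).1ᵀ * (θ k).1)⁻¹ *ᵥ z)) with hv
  have hvT : ∀ k, (θ k).1ᵀ *ᵥ v k = d k • z := by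
    intro k
    simp only [hv]
    rw [mulVec_smul, hG]
  set η : ℝ → Param K m n := fun ε k => ((θ k).1, (θ k).2 + ε • toLp 2 (v k)) with hη
  have hcont : Continuous η := by
    refine continuous_pi fun k => continuous_const.prodMk ?_
    fun_prop
  have hη0 : η 0 = θ := by
    funext k
    simp [hη]
  have hev : ∀ᶠ ε in 𝓝 (0 : ℝ), η ε ∈ interior Θ :=
    hcont.continuousAt.eventually (by rw [hη0]; exact isOpen_interior.mem_nhds hθ)
  obtain ⟨ε, hε, hε0⟩ := ((hev.filter_mono nhdsWithin_le_nhds).and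
    (self_mem_nhdsWithin : {(0 : ℝ)}ᶜ ∈ 𝓝[≠] 0)).exists
  have hresp : ∀ k, response (η ε k) x - ystar = ε • toLp 2 (v k) := by
    intro k
    rw [← sub_eq_zero, ← hres k]
    simp only [hη, response]
    abel
  refine ⟨η ε, hε, x, k₀, hrank, ?_, ?_, hopt⟩
  · simp only [halfGradient, hresp, ofLp_smul, mulVec_smul]
    have : ∀ k, (η ε k).1ᵀ *ᵥ v k = d k • z := hvT
    simp only [this]
    simp only [← Finset.smul_sum, ← Finset.sum_smul]
    simp [hd]
  · rw [hresp]
    intro h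
    rcases smul_eq_zero.1 h with h | h
    · exact hε0 h
    · have := hvT k₀
      rw [(toLp_eq_zero 2).1 h] at this
      simp [hd, h01] at this
      exact hz this.symm

end Optimal

/-! ### The perturbed family -/

section Family

variable {K m n : ℕ}

/-- The perturbation `A_k + δ r eᵢᵀ`, `b_k - δ xᵢ r` of state `k`, which does not change the
response at `x`. -/
noncomputable def tilt (θ : Param K m n) (k : Fin K) (r : EuclideanSpace ℝ (Fin m)) (i : Fin n)
    (x : EuclideanSpace ℝ (Fin n)) (δ : ℝ) : Param K m n :=
  Function.update θ k
    ((θ k).1 + δ • vecMulVec (ofLp r) (Pi.single i 1), (θ k).2 - (δ * x i) • r)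

theorem tilt_zero (θ : Param K m n) (k : Fin K) (r : EuclideanSpace ℝ (Fin m)) (i : Fin n)
    (x : EuclideanSpace ℝ (Fin n)) : tilt θ k r i x 0 = θ := by
  simp [tilt]

theorem continuous_tilt (θ : Param K m n) (k : Fin K) (r : EuclideanSpace ℝ (Fin m)) (i : Fin n)
    (x : EuclideanSpace ℝ (Fin n)) : Continuous (tilt θ k r i x) := by
  refine continuous_const.update k (Continuous.prodMk ?_ ?_)
  · exact continuous_const.add (continuous_id.smul continuous_const)
  · fun_prop

theorem response_tilt (θ : Param K m n) (k : Fin K) (r : EuclideanSpace ℝ (Fin m)) (i : Fin n)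
    (x : EuclideanSpace ℝ (Fin n)) (δ : ℝ) (j : Fin K) (z : EuclideanSpace ℝ (Fin n)) :
    response (tilt θ k r i x δ j) z =
      response (θ j) z + (if j = k then δ * (z i - x i) else 0) • r := by
  by_cases h : j = k
  · subst h
    ext l
    simp [tilt, response, add_mulVec, smul_mulVec, vecMulVec_mulVec]
    ring
  · simp [tilt, h]

/-- The residuals at `x` do not move, so only the change of `A_kᵀ` counts. Tilting along the
residual `r` itself makes this change act on `r` as `δ ‖r‖² eᵢ`. -/
theorem halfGradient_tilt (ystar : EuclideanSpace ℝ (Fin m)) (θ : Param K m n) (k : Fin K)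
    (i : Fin n) (x : EuclideanSpace ℝ (Fin n)) (δ : ℝ) :
    halfGradient ystar (tilt θ k (response (θ k) x - ystar) i x δ) x =
      halfGradient ystar θ x +
        δ • Pi.single i ((K : ℝ)⁻¹ * ‖response (θ k) x - ystar‖ ^ 2) := by
  set r := response (θ k) x - ystar with hr
  have hnorm : ofLp r ⬝ᵥ ofLp r = ‖r‖ ^ 2 := by
    rw [EuclideanSpace.norm_sq_eq]
    simp [dotProduct, sq]
  rw [halfGradient, halfGradient, ← sub_eq_iff_eq_add', ← Finset.sum_sub_distrib,
    Finset.sum_eq_single k]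
  · simp only [response_tilt, sub_self, mul_zero, ite_self, zero_smul, add_zero, ← smul_sub,
      ← sub_mulVec, ← hr]
    simp only [tilt, Function.update_self, transpose_add, add_sub_cancel_left, transpose_smul,
      transpose_vecMulVec, smul_mulVec, vecMulVec_mulVec, hnorm]
    ext l
    by_cases hl : l = i
    · subst hl; simp; ring
    · simp [hl]
  · intro j _ hj
    simp [tilt, hj]
  · simp

theorem exists_tilt_bounds (hK : 0 < K) (ystar : EuclideanSpace ℝ (Fin m)) {Θ : Set (Param K m n)}
    {Pi0 : Set (EuclideanSpace ℝ (Fin n))} {θ : Param K m n} {x : EuclideanSpace ℝ (Fin n)}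
    {k : Fin K} (i₀ : Fin n) (hθ : θ ∈ interior Θ) (hx : x ∈ interior Pi0)
    (hrank : ∀ k, (θ k).1.rank = n) (hgrad : halfGradient ystar θ x = 0)
    (hres : response (θ k) x - ystar ≠ 0) :
    ∃ c > 0, ∃ δ₀ > 0, ∀ δ : ℝ, 0 ≤ δ → δ ≤ δ₀ →
      tilt θ k (response (θ k) x - ystar) i₀ x δ ∈ Θ ∧
      (∀ j, (tilt θ k (response (θ k) x - ystar) i₀ x δ j).1.rank = n) ∧
      ∃ x', (∀ i, optimalInput ystar (tilt θ k (response (θ k) x - ystar) i₀ x δ)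
        (Matrix.of fun _ _ => (K : ℝ)⁻¹) i = x') ∧ x' ∈ Pi0 ∧ c * δ ^ 2 ≤ ‖x - x'‖ ^ 2 := by
  set r := response (θ k) x - ystar with hr
  set η : ℝ → Param K m n := tilt θ k r i₀ x with hη
  have hη0 : η 0 = θ := tilt_zero _ _ _ _ _
  have hcont : Continuous η := continuous_tilt _ _ _ _ _
  have hA : ∀ j, Continuous fun δ => (η δ j).1 := fun j =>
    continuous_fst.comp ((continuous_apply j).comp hcont)
  have hgram : Continuous fun δ => gram (η δ) := by
    refine continuous_finsetSum _ fun j _ => ?_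
    exact ((hA j).matrix_transpose.matrix_mul (hA j)).const_smul (K : ℝ)⁻¹
  have hdet0 : (gram (η 0)).det ≠ 0 := by rw [hη0]; exact det_gram_ne_zero hK hrank
  -- The Newton step from `x` is `δ • h δ`. As `h` is continuous at `0` with `h 0 ≠ 0`, the
  -- displacement exceeds `δ ‖h 0‖ / 2` for small `δ > 0`.
  set h : ℝ → EuclideanSpace ℝ (Fin n) := fun δ =>
    toLp 2 ((gram (η δ))⁻¹ *ᵥ Pi.single i₀ ((K : ℝ)⁻¹ * ‖r‖ ^ 2)) with hh
  have hinv : ContinuousAt (fun δ => (gram (η δ))⁻¹) 0 := by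
    refine ContinuousAt.comp (g := fun M : Matrix (Fin n) (Fin n) ℝ => M⁻¹) ?_
      hgram.continuousAt
    refine continuousAt_matrix_inv _ ?_
    rw [Ring.inverse_eq_inv']
    exact continuousAt_inv₀ hdet0
  have hhc : ContinuousAt h 0 := by
    refine (PiLp.continuous_toLp 2 _).continuousAt.comp ?_
    refine ContinuousAt.comp (g := fun M : Matrix (Fin n) (Fin n) ℝ =>
      M *ᵥ Pi.single i₀ ((K : ℝ)⁻¹ * ‖r‖ ^ 2)) ?_ hinv
    exact (Continuous.matrix_mulVec continuous_id continuous_const).continuousAt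
  have hh0 : h 0 ≠ 0 := by
    intro h0
    have h1 := congrArg (fun v => gram (η 0) *ᵥ v) ((toLp_eq_zero 2).1 h0)
    simp only [mulVec_mulVec, mul_nonsing_inv _ hdet0.isUnit, one_mulVec, mulVec_zero,
      Pi.single_eq_zero_iff] at h1
    have h2 : 0 < ‖r‖ := norm_pos_iff.2 hres
    have h3 : 0 < (K : ℝ)⁻¹ * ‖r‖ ^ 2 := by positivity
    exact h3.ne' h1
  have e1 : ∀ᶠ δ in 𝓝 (0 : ℝ), η δ ∈ Θ :=
    hcont.continuousAt.eventually (by rw [hη0]; exact mem_interior_iff_mem_nhds.1 hθ)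
  have e2 : ∀ᶠ δ in 𝓝 (0 : ℝ), ∀ j, (η δ j).1.rank = n := by
    refine eventually_all.2 fun j => ?_
    simp only [rank_eq_iff_det_gram_ne_zero]
    refine ((hA j).matrix_transpose.matrix_mul (hA j)).matrix_det.continuousAt.eventually_ne ?_
    rw [hη0]
    exact (rank_eq_iff_det_gram_ne_zero _).1 (hrank j)
  have e3 : ∀ᶠ δ in 𝓝 (0 : ℝ), x - δ • h δ ∈ Pi0 := by
    have hc : ContinuousAt (fun δ : ℝ => x - δ • h δ) 0 :=
      continuousAt_const.sub (continuousAt_id.smul hhc)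
    refine hc.eventually ?_
    simp only [zero_smul, sub_zero]
    exact mem_interior_iff_mem_nhds.1 hx
  have e4 : ∀ᶠ δ in 𝓝 (0 : ℝ), ‖h 0‖ / 2 < ‖h δ‖ :=
    hhc.norm.eventually_const_lt (half_lt_self (norm_pos_iff.2 hh0))
  obtain ⟨ε, hε, hall⟩ := Metric.eventually_nhds_iff.1 (e1.and (e2.and (e3.and e4)))
  have hpos : 0 < ‖h 0‖ := norm_pos_iff.2 hh0
  refine ⟨(‖h 0‖ / 2) ^ 2, by positivity, ε / 2, by positivity, fun δ hδ0 hδ => ?_⟩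
  obtain ⟨h1, h2, h3, h4⟩ := hall (y := δ) (by
    rw [Real.dist_eq, sub_zero, abs_of_nonneg hδ0]; linarith)
  refine ⟨h1, h2, x - δ • h δ, fun i => ?_, h3, ?_⟩
  · rw [optimalInput_uniform ystar (det_gram_ne_zero hK h2) x i, halfGradient_tilt, ← hr, hgrad,
      zero_add, mulVec_smul, toLp_smul]
  · rw [sub_sub_cancel, norm_smul, Real.norm_of_nonneg hδ0, mul_comm, ← mul_pow]
    gcongr

end Family

/-! ### Choice of the separation and conclusion -/

/-- The optimization over the separation `δ` of the two systems. -/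
theorem mul_ge_of_two_point {c δ₀ M : ℝ} (hc : 0 < c) (hδ₀ : 0 < δ₀) (hM : 0 ≤ M) :
    ∃ C : ℝ, 0 < C ∧ ∀ (T : ℕ) (E I : ℝ≥0∞),
      (0 < T → ENNReal.ofReal (c * δ₀ ^ 2 / 2) ≤ 2 * E) →
      (0 < T → ENNReal.ofReal (c * δ₀ ^ 2 / 2) ≤ 2 * I) →
      (∀ δ, 0 ≤ δ → δ ≤ δ₀ → ∃ D, c * δ ^ 2 ≤ D ∧
        T * ENNReal.ofReal (D / 2) * ENNReal.ofReal (3 / 4) ≤ 2 * E +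
          T * ENNReal.ofReal (D / 2) * (ENNReal.ofReal (3 / 2) *
            (ENNReal.ofReal (M * δ ^ 2) * I))) →
      ENNReal.ofReal (C * T) ≤ E * I := by
  -- With `δ² = κ / I`, the first bound and `I ≥ c δ₀² / 4` give `δ ≤ δ₀`; the second gives `M δ² I
  -- ≤ 1/4`.
  set κ : ℝ := min (c * δ₀ ^ 2 / 4 * δ₀ ^ 2) (1 / (4 * (M + 1))) with hκ
  have hκ0 : 0 < κ := lt_min (by positivity) (by positivity)
  refine ⟨3 * c * κ / 32, by positivity, fun T E I hE hI hB => ?_⟩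
  rcases Nat.eq_zero_or_pos T with rfl | hT
  · simp
  specialize hE hT
  specialize hI hT
  have hpos : ENNReal.ofReal (c * δ₀ ^ 2 / 2) ≠ 0 := by
    simp only [ne_eq, ENNReal.ofReal_eq_zero, not_le]; positivity
  have hE0 : E ≠ 0 := by rintro rfl; exact hpos (by simpa using hE)
  have hI0 : I ≠ 0 := by rintro rfl; exact hpos (by simpa using hI)
  rcases eq_or_ne I ∞ with rfl | hIt
  · rw [ENNReal.mul_top hE0]; exact le_top
  rcases eq_or_ne E ∞ with rfl | hEt
  · rw [ENNReal.top_mul hI0]; exact le_top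
  lift E to NNReal using hEt
  lift I to NNReal using hIt
  have hI' : c * δ₀ ^ 2 / 4 ≤ (I : ℝ) := by
    have h := ENNReal.toReal_mono (by finiteness) hI
    rw [ENNReal.toReal_ofReal (by positivity)] at h
    simp at h
    linarith
  have hIpos : (0 : ℝ) < I := lt_of_lt_of_le (by positivity) hI'
  set δ : ℝ := √(κ / I) with hδ
  have hδsq : δ ^ 2 = κ / I := Real.sq_sqrt (by positivity)
  have hδle : δ ≤ δ₀ := by
    refine Real.sqrt_le_iff.2 ⟨hδ₀.le, ?_⟩
    rw [div_le_iff₀ hIpos]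
    calc κ ≤ c * δ₀ ^ 2 / 4 * δ₀ ^ 2 := min_le_left _ _
      _ ≤ I * δ₀ ^ 2 := by gcongr
      _ = _ := mul_comm _ _
  obtain ⟨D, hD, h⟩ := hB δ (Real.sqrt_nonneg _) hδle
  have hD0 : 0 ≤ D := le_trans (by positivity) hD
  have h2 := ENNReal.toReal_mono (by finiteness) h
  rw [ENNReal.toReal_add (by finiteness) (by finiteness)] at h2
  simp only [ENNReal.toReal_mul, ENNReal.toReal_natCast, ENNReal.toReal_ofNat,
    ENNReal.coe_toReal] at h2
  rw [ENNReal.toReal_ofReal (by positivity), ENNReal.toReal_ofReal (by positivity),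
    ENNReal.toReal_ofReal (by positivity), ENNReal.toReal_ofReal (by positivity)] at h2
  have hMI : M * δ ^ 2 * I ≤ 1 / 4 := by
    rw [hδsq, mul_assoc, div_mul_cancel₀ _ hIpos.ne']
    calc M * κ ≤ M * (1 / (4 * (M + 1))) := by gcongr; exact min_le_right _ _
      _ ≤ 1 / 4 := by rw [mul_one_div, div_le_div_iff₀ (by positivity) (by norm_num)]; linarith
  have hTD : 0 ≤ (T : ℝ) * (D / 2) := by positivity
  -- What remains is `3/4 - 3/2 * 1/4 = 3/8` of `T D / 2`, to be compared with `2 E`.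
  have h3 : 3 / 32 * (T * D) ≤ (E : ℝ) := by nlinarith
  have h4 : 3 / 32 * (T * (c * (κ / I))) ≤ (E : ℝ) := by
    refine le_trans ?_ h3
    rw [← hδsq]
    gcongr
  rw [← ENNReal.coe_mul, ← ENNReal.ofReal_coe_nnreal]
  refine ENNReal.ofReal_le_ofReal ?_
  rw [NNReal.coe_mul]
  calc 3 * c * κ / 32 * T = 3 / 32 * (T * (c * (κ / I))) * I := by field_simp
    _ ≤ E * I := by gcongr

end JumpAffine

theorem mainTheorem3 {K m n : ℕ} (hK : 1 < K) (hn : 0 < n)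
    (ystar : EuclideanSpace ℝ (Fin m)) (σ : ℝ) (hσ : 0 < σ)
    (Pi0 : Set (EuclideanSpace ℝ (Fin n))) (hPi_convex : Convex ℝ Pi0) (hPi_compact : IsCompact Pi0)
    (Θ : Set (JumpAffine.Param K m n)) (hΘ : IsCompact Θ)
    (hint : ∃ θ ∈ interior Θ, (∀ k, (θ k).1.rank = n) ∧
      ∀ i, JumpAffine.optimalInput ystar θ (Matrix.of fun _ _ => (K : ℝ)⁻¹) i ∈ interior Pi0) :
    ∃ C : ℝ, 0 < C ∧
      ∀ (π : Fin K → ℝ), π ∈ stdSimplex ℝ (Fin K) →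
      ∀ (U : Type*) [MeasurableSpace U] (ρ : Measure U) [IsProbabilityMeasure ρ]
        (μ est : JumpAffine.CausalRule K m n U) (T : ℕ),
        ENNReal.ofReal (C * T) ≤
          JumpAffine.worstEstimationMSE T ystar σ Θ Pi0 ρ π μ est *
            JumpAffine.worstInputMSE T ystar σ Θ Pi0 ρ π μ := by
  open JumpAffine in
  have hK0 : 0 < K := by omega
  obtain ⟨θ₀, hθ₀, hrank₀, hopt₀⟩ := hint
  obtain ⟨θ, hθ, x, k, hrank, hgrad, hres, hx⟩ :=
    exists_interior_residual_ne_zero hK hn ystar hθ₀ hrank₀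
  have hxPi : x ∈ interior Pi0 := hx ⟨0, hK0⟩ ▸ hopt₀ ⟨0, hK0⟩
  set i₀ : Fin n := ⟨0, hn⟩
  obtain ⟨c, hc, δ₀, hδ₀, hfam⟩ := exists_tilt_bounds hK0 ystar i₀ hθ hxPi hrank hgrad hres
  obtain ⟨τ, hτ, hnoise⟩ := exists_isNoiseLaw_lineGaussian hσ m
  set q : EuclideanSpace ℝ (Fin m) := response (θ k) x - ystar with hq
  have hq0 : 0 < ‖q‖ := norm_pos_iff.2 hres
  -- The noise must lie along `q` to mask the tilt; the rescaling meets the moment bounds and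
  -- contributes the factor `‖q‖ / τ` to the shift.
  set r : EuclideanSpace ℝ (Fin m) := (τ / ‖q‖) • q with hr
  have hrn : ‖r‖ ≤ τ := by
    rw [hr, norm_smul, Real.norm_of_nonneg (by positivity), div_mul_cancel₀ _ hq0.ne']
  have hqr : q = (‖q‖ / τ) • r := by
    rw [hr, smul_smul, div_mul_div_cancel₀ hτ.ne', div_self hq0.ne', one_smul]
  have hstoch : (Matrix.of fun _ _ => (K : ℝ)⁻¹) ∈ Matrix.rowStochastic ℝ (Fin K) := by
    rw [Matrix.mem_rowStochastic_iff_sum]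
    refine ⟨fun _ _ => by simp, fun _ => ?_⟩
    have : (K : ℝ) ≠ 0 := by positivity
    simp [this]
  have hxopt : ∀ i, optimalInput ystar θ (Matrix.of fun _ _ => (K : ℝ)⁻¹) i = x := fun i => by
    rw [optimalInput_uniform ystar (det_gram_ne_zero hK0 hrank) x, hgrad]
    simp
  have hadm : IsAdmissible ystar σ Θ Pi0 θ (Matrix.of fun _ _ => (K : ℝ)⁻¹)
      (fun _ => lineGaussian r) :=
    ⟨interior_subset hθ, hrank, hstoch, fun _ => hnoise r hrn, fun i => by
      rw [hxopt]; exact interior_subset hxPi⟩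
  set M : ℝ := (‖q‖ / τ) ^ 2 with hM
  obtain ⟨C, hC, hmain⟩ := mul_ge_of_two_point hc hδ₀ (sq_nonneg (‖q‖ / τ))
  refine ⟨C, hC, fun π hπ U _ ρ _ μ est T => ?_⟩
  -- With `e = μ` the right-hand side is by definition the worst input error, so both errors are
  -- covered.
  have hle : ∀ (e : CausalRule K m n U) (η : Param K m n),
      IsAdmissible ystar σ Θ Pi0 η (Matrix.of fun _ _ => (K : ℝ)⁻¹) (fun _ => lineGaussian r) →
      cumulativeMSE T ystar ρ π μ e η (Matrix.of fun _ _ => (K : ℝ)⁻¹)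
        (fun _ => lineGaussian r) ≤ worstEstimationMSE T ystar σ Θ Pi0 ρ π μ e := by
    intro e η hη
    unfold worstEstimationMSE
    exact le_iSup_of_le η (le_iSup_of_le _ (le_iSup_of_le _ (le_iSup_of_le hη le_rfl)))
  have hadm' : ∀ δ, 0 ≤ δ → δ ≤ δ₀ → IsAdmissible ystar σ Θ Pi0 (tilt θ k q i₀ x δ)
      (Matrix.of fun _ _ => (K : ℝ)⁻¹) (fun _ => lineGaussian r) := by
    intro δ h0 h1
    obtain ⟨hmem, hrk, x', hx', hx'Pi, -⟩ := hfam δ h0 h1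
    exact ⟨hmem, hrk, hstoch, fun _ => hnoise r hrn, fun i => by rw [hx']; exact hx'Pi⟩
  have hstart : ∀ e : CausalRule K m n U, 0 < T → ENNReal.ofReal (c * δ₀ ^ 2 / 2) ≤
      2 * worstEstimationMSE T ystar σ Θ Pi0 ρ π μ e := by
    intro e hT
    obtain ⟨-, -, x', hx', -, hsep⟩ := hfam δ₀ hδ₀.le le_rfl
    refine (ENNReal.ofReal_le_ofReal (by linarith)).trans
      ((cumulativeMSE_add_ge_of_pos hK0 ρ hπ hT μ e r hxopt hx').trans ?_)
    rw [two_mul]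
    exact add_le_add (hle e _ hadm) (hle e _ (hadm' δ₀ hδ₀.le le_rfl))
  refine hmain T _ _ (hstart est) (hstart μ) fun δ h0 h1 => ?_
  obtain ⟨-, -, x', hx', -, hsep⟩ := hfam δ h0 h1
  refine ⟨‖x - x'‖ ^ 2, hsep, ?_⟩
  refine (cumulativeMSE_add_ge (T := T) (M := M * δ ^ 2) hK0 ρ hπ μ est hxopt hx'
    (φ := fun j z => if j = k then δ * (z i₀ - x i₀) * (‖q‖ / τ) else 0) (r := r)
    (fun j => ?_) (fun j z => ?_) (by positivity) (fun j z => ?_)).trans ?_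
  · by_cases h : j = k
    · simp only [h, if_true]; fun_prop
    · simp [h]
  · rw [response_tilt]
    congr 1
    by_cases h : j = k
    · simp only [h, if_true]
      rw [mul_smul _ (‖q‖ / τ), ← hqr]
    · simp [h]
  · by_cases h : j = k
    · have h2 : (z i₀ - x i₀) ^ 2 ≤ ‖z - x‖ ^ 2 := by
        have := PiLp.norm_apply_le (z - x) i₀
        rw [← sq_abs (z i₀ - x i₀)]
        gcongr
        simpa using this
      simp only [h, if_true]
      calc (δ * (z i₀ - x i₀) * (‖q‖ / τ)) ^ 2 = M * δ ^ 2 * (z i₀ - x i₀) ^ 2 := by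
            rw [hM]; ring
        _ ≤ _ := by gcongr
    · simp only [h, if_false]
      rw [zero_pow two_ne_zero]; positivity
  · rw [two_mul]
    gcongr
    · exact hle est _ hadm
    · exact hle est _ (hadm' δ h0 h1)
    · exact hle μ _ hadm
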